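/- All algebras are over $\mathbb C$ and need not be unital; $M(\cdot)$ denotes the multiplier algebra. Let $(A,\Delta)$ be an algebraic quantum group: the product of $A$ is non-degenerate, $\Delta:A\to M(A\otimes A)$ is a coassociative homomorphism such that $a\otimes b\mapsto\Delta(a)(1\otimes b)$ and $a\otimes b\mapsto(a\otimes 1)\Delta(b)$ are bijections of $A\otimes A$ onto itself, the same holds for the flipped coproduct (regularity), and there is a left integral, i.e. a non-zero linear functional $\varphi$ on $A$ with $(\iota\otimes\varphi)\Delta(a)=\varphi(a)1$ in $M(A)$ for all $a\in A$. Fix $\varphi$. Let $B=\widehat A=\{\varphi(\,\cdot\,c): c\in A\}$ be the dual, paired with $A$ by evaluation, $\langle a,\varphi(\,\cdot\,c)\rangle=\varphi(ac)$. Its product is given by $\langle a,bb'\rangle=\langle\Delta(a),b\otimes b'\rangle$ and its coproduct by $\langle a\otimes a',\Delta(b)\rangle=\langle aa',b\rangle$. Let $b\triangleright a=(\iota\otimes\langle\,\cdot\,,b\rangle)\Delta(a)\in A$ be the left action of $B$ on $A$. The Heisenberg algebra $AB$ is the vector space $A\otimes B$ with the product $$(a\otimes b)(a'\otimes b')=\sum_{(a')(b)}\langle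 a'_{(2)},b_{(1)}\rangle\,aa'_{(1)}\otimes b_{(2)}b',$$ that is, $(a\otimes b)(a'\otimes b')=\sum_i a(p_i\triangleright a')\otimes q_i$ where $\sum_i p_i\otimes q_i=\Delta(b)(1\otimes b')\in B\otimes B$. Proposition 3.16. The Heisenberg algebra $AB$ is isomorphic, as an algebra, with the algebra of operators on $A$ spanned by the rank one operators $x\mapsto a\langle x,b\rangle$ with $a\in A$ and $b\in B$. An isomorphism is given by the action of $AB$ on $A$, which sends $a\otimes b$ to the operator $x\mapsto a(b\triangleright x)$. -/

import Mathlib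

open scoped TensorProduct


noncomputable section

namespace QGroup

section Multipliers

variable (A : Type*) [NonUnitalRing A] [Module ℂ A] [SMulCommClass ℂ A A] [IsScalarTower ℂ A A]

/-- The product of `A` is non-degenerate. -/
def Nondegenerate : Prop :=
  (∀ a : A, (∀ b, a * b = 0) → a = 0) ∧ (∀ a : A, (∀ b, b * a = 0) → a = 0)

/-- The multiplier algebra, as a subalgebra of `End(A) × End(A)ᵒᵖ`: pairs `(L, R)` of linear maps
`A → A`, thought of as `L a = m a` and `R a = a m`, with `m (a b) = (m a) b`, `(a b) m = a (b m)` and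
`(a m) b = a (m b)`.  The product is `m n = (L_m ∘ L_n, R_n ∘ R_m)`. -/
def multiplierSubalgebra : Subalgebra ℂ (Module.End ℂ A × (Module.End ℂ A)ᵐᵒᵖ) where
  carrier := {m | (∀ a b, m.1 (a * b) = m.1 a * b) ∧
    (∀ a b, m.2.unop (a * b) = a * m.2.unop b) ∧ (∀ a b, m.2.unop a * b = a * m.1 b)}
  mul_mem' := by
    rintro m n ⟨h1, h2, h3⟩ ⟨k1, k2, k3⟩
    refine ⟨fun a b => ?_, fun a b => ?_, fun a b => ?_⟩
    · simp [h1, k1]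
    · simp [h2, k2]
    · simp [h3, k3]
  add_mem' := by
    rintro m n ⟨h1, h2, h3⟩ ⟨k1, k2, k3⟩
    refine ⟨fun a b => ?_, fun a b => ?_, fun a b => ?_⟩
    · simp [h1, k1, add_mul]
    · simp [h2, k2, mul_add]
    · simp [h3, k3, add_mul, mul_add]
  algebraMap_mem' := by
    intro r
    refine ⟨fun a b => ?_, fun a b => ?_, fun a b => ?_⟩ <;>
      simp [Algebra.algebraMap_eq_smul_one, smul_mul_assoc, mul_smul_comm]

/-- The multiplier algebra `M(A)`. -/
def MultiplierAlgebra : Type _ := multiplierSubalgebra A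

instance : Ring (MultiplierAlgebra A) := inferInstanceAs (Ring (multiplierSubalgebra A))

instance : Algebra ℂ (MultiplierAlgebra A) :=
  inferInstanceAs (Algebra ℂ (multiplierSubalgebra A))

instance : NonUnitalNonAssocSemiring (MultiplierAlgebra A) :=
  NonAssocSemiring.toNonUnitalNonAssocSemiring

instance : AddCommMonoid (MultiplierAlgebra A) :=
  NonUnitalNonAssocSemiring.toAddCommMonoid

instance : Module ℂ (MultiplierAlgebra A) := Algebra.toModule

instance : DistribMulAction ℂ (MultiplierAlgebra A) := Module.toDistribMulAction

end Multipliers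

section TensorInstances

variable {A : Type*} [NonUnitalRing A] [Module ℂ A] [SMulCommClass ℂ A A] [IsScalarTower ℂ A A]

instance : NonUnitalRing (A ⊗[ℂ] A) := Algebra.TensorProduct.instNonUnitalRing

instance : SMulCommClass ℂ (A ⊗[ℂ] A) (A ⊗[ℂ] A) := Algebra.TensorProduct.sMulCommClass_right

instance : IsScalarTower ℂ (A ⊗[ℂ] A) (A ⊗[ℂ] A) := Algebra.TensorProduct.isScalarTower_right

end TensorInstances

section MultiplierOps

variable {A : Type*} [NonUnitalRing A] [Module ℂ A] [SMulCommClass ℂ A A] [IsScalarTower ℂ A A]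

/-- `m.left a = m a`. -/
def MultiplierAlgebra.left (m : MultiplierAlgebra A) : A →ₗ[ℂ] A := m.1.1

/-- `m.right a = a m`. -/
def MultiplierAlgebra.right (m : MultiplierAlgebra A) : A →ₗ[ℂ] A := m.1.2.unop

theorem MultiplierAlgebra.ext' {m n : MultiplierAlgebra A} (h : m.left = n.left)
    (h' : m.right = n.right) : m = n :=
  Subtype.ext (Prod.ext h (MulOpposite.unop_injective h'))

@[simp] theorem MultiplierAlgebra.left_mul (m n : MultiplierAlgebra A) (a : A) :
    (m * n).left a = m.left (n.left a) := rfl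

@[simp] theorem MultiplierAlgebra.right_mul (m n : MultiplierAlgebra A) (a : A) :
    (m * n).right a = n.right (m.right a) := rfl

/-- The canonical map `A → M(A)`. -/
def ofElem : A →ₗ[ℂ] MultiplierAlgebra A where
  toFun a := ⟨(LinearMap.mulLeft ℂ a, MulOpposite.op (LinearMap.mulRight ℂ a)),
    fun b c => by simp [mul_assoc], fun b c => by simp [mul_assoc],
    fun b c => by simp [mul_assoc]⟩
  map_add' a b := MultiplierAlgebra.ext' (by ext x; exact add_mul a b x)
    (by ext x; exact mul_add x a b)
  map_smul' r a := MultiplierAlgebra.ext' (by ext x; exact smul_mul_assoc r a x)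
    (by ext x; exact mul_smul_comm r x a)

theorem ofElem_injective (h : Nondegenerate A) :
    Function.Injective (ofElem : A →ₗ[ℂ] MultiplierAlgebra A) := by
  rw [injective_iff_map_eq_zero]
  intro a ha
  exact h.1 a fun b => congrArg (fun m : MultiplierAlgebra A => m.left b) ha

@[simp] theorem ofElem_left (a x : A) : (ofElem a).left x = a * x := rfl

@[simp] theorem ofElem_right (a x : A) : (ofElem a).right x = x * a := rfl

theorem mul_ofElem (m : MultiplierAlgebra A) (a : A) : m * ofElem a = ofElem (m.left a) :=
  MultiplierAlgebra.ext' (by ext x; exact m.2.1 a x) (by ext x; exact m.2.2.2 x a)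

theorem ofElem_mul (m : MultiplierAlgebra A) (a : A) : ofElem a * m = ofElem (m.right a) :=
  MultiplierAlgebra.ext' (by ext x; exact (m.2.2.2 a x).symm) (by ext x; exact m.2.2.1 x a)

/-- The multiplier `a ⊗ 1` of `A ⊗ A`. -/
def leg₁ (a : A) : MultiplierAlgebra (A ⊗[ℂ] A) :=
  ⟨((LinearMap.mulLeft ℂ a).rTensor A, MulOpposite.op ((LinearMap.mulRight ℂ a).rTensor A)), by
    refine ⟨fun s t => ?_, fun s t => ?_, fun s t => ?_⟩ <;>
    induction s using TensorProduct.induction_on with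
    | zero => simp
    | add s s' hs hs' => simp_all [add_mul]
    | tmul x y =>
      induction t using TensorProduct.induction_on with
      | zero => simp
      | add t t' ht ht' => simp_all [mul_add]
      | tmul z w => simp [mul_assoc]⟩

/-- The multiplier `1 ⊗ a` of `A ⊗ A`. -/
def leg₂ (a : A) : MultiplierAlgebra (A ⊗[ℂ] A) :=
  ⟨((LinearMap.mulLeft ℂ a).lTensor A, MulOpposite.op ((LinearMap.mulRight ℂ a).lTensor A)), by
    refine ⟨fun s t => ?_, fun s t => ?_, fun s t => ?_⟩ <;>
    induction s using TensorProduct.induction_on with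
    | zero => simp
    | add s s' hs hs' => simp_all [add_mul]
    | tmul x y =>
      induction t using TensorProduct.induction_on with
      | zero => simp
      | add t t' ht ht' => simp_all [mul_add]
      | tmul z w => simp [mul_assoc]⟩

@[simp] theorem leg₁_left (a x y : A) : (leg₁ a).left (x ⊗ₜ[ℂ] y) = (a * x) ⊗ₜ y := rfl

@[simp] theorem leg₁_right (a x y : A) : (leg₁ a).right (x ⊗ₜ[ℂ] y) = (x * a) ⊗ₜ y := rfl

@[simp] theorem leg₂_left (a x y : A) : (leg₂ a).left (x ⊗ₜ[ℂ] y) = x ⊗ₜ (a * y) := rfl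

@[simp] theorem leg₂_right (a x y : A) : (leg₂ a).right (x ⊗ₜ[ℂ] y) = x ⊗ₜ (y * a) := rfl

/-- The flip map `x ⊗ y ↦ y ⊗ x` of `A ⊗ A`. -/
def swap : A ⊗[ℂ] A →ₗ[ℂ] A ⊗[ℂ] A := (TensorProduct.comm ℂ A A).toLinearMap

@[simp] theorem swap_tmul (x y : A) : swap (x ⊗ₜ[ℂ] y) = y ⊗ₜ x := rfl

@[simp] theorem swap_swap (t : A ⊗[ℂ] A) : swap (swap t) = t :=
  (TensorProduct.comm ℂ A A).symm_apply_apply t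

theorem swap_mul (s t : A ⊗[ℂ] A) : swap (s * t) = swap s * swap t := by
  induction s using TensorProduct.induction_on with
  | zero => simp
  | add s s' hs hs' => simp_all [add_mul]
  | tmul x y =>
    induction t using TensorProduct.induction_on with
    | zero => simp
    | add t t' ht ht' => simp_all [mul_add]
    | tmul z w => simp

/-- The extension of the flip map to `M(A ⊗ A)`. -/
def flipM : MultiplierAlgebra (A ⊗[ℂ] A) →ₙₐ[ℂ] MultiplierAlgebra (A ⊗[ℂ] A) where
  toFun m := ⟨(swap ∘ₗ m.left ∘ₗ swap, MulOpposite.op (swap ∘ₗ m.right ∘ₗ swap)), by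
    refine ⟨fun s t => ?_, fun s t => ?_, fun s t => ?_⟩
    · have := congrArg swap (m.2.1 (swap s) (swap t))
      rw [swap_mul _ (swap t), swap_swap, ← swap_mul s t] at this
      exact this
    · have := congrArg swap (m.2.2.1 (swap s) (swap t))
      rw [swap_mul (swap s) _, swap_swap, ← swap_mul s t] at this
      exact this
    · have := congrArg swap (m.2.2.2 (swap s) (swap t))
      rw [swap_mul, swap_mul, swap_swap, swap_swap] at this
      exact this⟩
  map_smul' r m := MultiplierAlgebra.ext' (LinearMap.ext fun t => map_smul swap r _)
    (LinearMap.ext fun t => map_smul swap r _)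
  map_zero' := MultiplierAlgebra.ext' (LinearMap.ext fun t => map_zero swap)
    (LinearMap.ext fun t => map_zero swap)
  map_add' m n := MultiplierAlgebra.ext' (LinearMap.ext fun t => map_add swap _ _)
    (LinearMap.ext fun t => map_add swap _ _)
  map_mul' m n := MultiplierAlgebra.ext'
    (LinearMap.ext fun t => by
      change swap (m.left (n.left (swap t))) = swap (m.left (swap (swap (n.left (swap t)))))
      rw [swap_swap])
    (LinearMap.ext fun t => by
      change swap (n.right (m.right (swap t))) = swap (n.right (swap (swap (m.right (swap t)))))
      rw [swap_swap])

end MultiplierOps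

section Structures

variable {A : Type*} [NonUnitalRing A] [Module ℂ A] [SMulCommClass ℂ A A] [IsScalarTower ℂ A A]

/-- `(A, Δ)` is a multiplier Hopf algebra: the product of `A` is non-degenerate; the elements
`Δ(a)(1 ⊗ b)` and `(a ⊗ 1)Δ(b)` of `M(A ⊗ A)` lie in `A ⊗ A`; the resulting maps
`T₁ : a ⊗ b ↦ Δ(a)(1 ⊗ b)` and `T₂ : a ⊗ b ↦ (a ⊗ 1)Δ(b)` are bijections of `A ⊗ A`;
and `Δ` is coassociative, i.e.
`(a ⊗ 1 ⊗ 1)(Δ ⊗ ι)(Δ(b)(1 ⊗ c)) = (ι ⊗ Δ)((a ⊗ 1)Δ(b))(1 ⊗ 1 ⊗ c)`. -/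
def IsMultiplierHopf (Δ : A →ₙₐ[ℂ] MultiplierAlgebra (A ⊗[ℂ] A)) : Prop :=
  Nondegenerate A ∧ ∃ T₁ T₂ : (A ⊗[ℂ] A) ≃ₗ[ℂ] (A ⊗[ℂ] A),
    (∀ a b, ofElem (T₁ (a ⊗ₜ b)) = Δ a * leg₂ b) ∧
    (∀ a b, ofElem (T₂ (a ⊗ₜ b)) = leg₁ a * Δ b) ∧
    ∀ a b c : A,
      TensorProduct.assoc ℂ A A A (T₂.toLinearMap.rTensor A
        ((TensorProduct.assoc ℂ A A A).symm (a ⊗ₜ T₁ (b ⊗ₜ c)))) =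
      T₁.toLinearMap.lTensor A (TensorProduct.assoc ℂ A A A (T₂ (a ⊗ₜ b) ⊗ₜ c))

/-- `(A, Δ)` is a regular multiplier Hopf algebra: both `Δ` and the flipped coproduct make `A`
into a multiplier Hopf algebra. -/
def IsRegularMultiplierHopf (Δ : A →ₙₐ[ℂ] MultiplierAlgebra (A ⊗[ℂ] A)) : Prop :=
  IsMultiplierHopf Δ ∧ IsMultiplierHopf (flipM.comp Δ)

end Structures

section Aux

variable {A : Type*} [NonUnitalRing A] [Module ℂ A] [SMulCommClass ℂ A A] [IsScalarTower ℂ A A]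

theorem rTensor_separates {M N P Q : Type*} [AddCommGroup M] [Module ℂ M] [AddCommGroup N]
    [Module ℂ N] [AddCommGroup P] [Module ℂ P] (f : Q → M →ₗ[ℂ] P)
    (hf : ∀ m, (∀ q, f q m = 0) → m = 0) (t : M ⊗[ℂ] N) (ht : ∀ q, (f q).rTensor N t = 0) :
    t = 0 := by
  classical
  let e := TensorProduct.equivFinsuppOfBasisRight (M := M) (Module.Free.chooseBasis ℂ N)
  let e' := TensorProduct.equivFinsuppOfBasisRight (M := P) (Module.Free.chooseBasis ℂ N)
  have key : ∀ q (t : M ⊗[ℂ] N) i, e' ((f q).rTensor N t) i = f q (e t i) := by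
    intro q t i
    induction t using TensorProduct.induction_on with
    | zero => simp
    | add s t hs ht => simp [hs, ht]
    | tmul x y => simp [e, e']
  apply e.injective
  rw [map_zero]
  ext i
  exact hf _ fun q => by rw [← key, ht]; simp

theorem mulLeft_add' (x y : A) :
    LinearMap.mulLeft ℂ (x + y) = LinearMap.mulLeft ℂ x + LinearMap.mulLeft ℂ y :=
  LinearMap.ext fun z => add_mul x y z

theorem mulLeft_smul' (r : ℂ) (x : A) :
    LinearMap.mulLeft ℂ (r • x) = r • LinearMap.mulLeft ℂ x :=
  LinearMap.ext fun z => smul_mul_assoc r x z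

theorem leg₁_right_swap (x : A) (t : A ⊗[ℂ] A) :
    (leg₁ x).right (swap t) = swap ((leg₂ x).right t) := by
  induction t using TensorProduct.induction_on with
  | zero => simp
  | add s t hs ht => simp only [map_add, hs, ht]
  | tmul y z => simp

theorem leg₁_left_swap (x : A) (t : A ⊗[ℂ] A) :
    (leg₁ x).left (swap t) = swap ((leg₂ x).left t) := by
  induction t using TensorProduct.induction_on with
  | zero => simp
  | add s t hs ht => simp only [map_add, hs, ht]
  | tmul y z => simp

theorem mul_tmul_eq (x y : A) (t : A ⊗[ℂ] A) :
    t * (x ⊗ₜ y) = (leg₁ x).right ((leg₂ y).right t) := by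
  induction t using TensorProduct.induction_on with
  | zero => simp
  | add s t hs ht => simp only [map_add, hs, ht, add_mul]
  | tmul y z => simp

theorem tmul_mul_eq (x y : A) (t : A ⊗[ℂ] A) :
    (x ⊗ₜ y) * t = (leg₁ x).left ((leg₂ y).left t) := by
  induction t using TensorProduct.induction_on with
  | zero => simp
  | add s t hs ht => simp only [map_add, hs, ht, mul_add]
  | tmul y z => simp

theorem leg₁_right_separates (h : Nondegenerate A) (t : A ⊗[ℂ] A)
    (ht : ∀ x, (leg₁ x).right t = 0) : t = 0 := by
  have h1 : ∀ x : A, (LinearMap.mulRight ℂ x).rTensor A t = 0 := ht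
  have h2 : ∀ m : A, (∀ x : A, LinearMap.mulRight ℂ x m = 0) → m = 0 := h.1
  exact rTensor_separates (fun x : A => LinearMap.mulRight ℂ x) h2 t h1

theorem leg₁_left_separates (h : Nondegenerate A) (t : A ⊗[ℂ] A)
    (ht : ∀ x, (leg₁ x).left t = 0) : t = 0 := by
  have h1 : ∀ x : A, (LinearMap.mulLeft ℂ x).rTensor A t = 0 := ht
  have h2 : ∀ m : A, (∀ x : A, LinearMap.mulLeft ℂ x m = 0) → m = 0 := h.2
  exact rTensor_separates (fun x : A => LinearMap.mulLeft ℂ x) h2 t h1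

theorem nondegenerate_tensor (h : Nondegenerate A) : Nondegenerate (A ⊗[ℂ] A) := by
  constructor
  · intro t ht
    have h0 : swap t = 0 := leg₁_right_separates h _ fun y => by
      have h1 : (leg₂ y).right t = 0 :=
        leg₁_right_separates h _ fun x => by rw [← mul_tmul_eq, ht]
      rw [leg₁_right_swap, h1, map_zero]
    rw [← swap_swap t, h0, map_zero]
  · intro t ht
    have h0 : swap t = 0 := leg₁_left_separates h _ fun y => by
      have h1 : (leg₂ y).left t = 0 :=
        leg₁_left_separates h _ fun x => by rw [← tmul_mul_eq, ht]
      rw [leg₁_left_swap, h1, map_zero]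
    rw [← swap_swap t, h0, map_zero]

theorem leg₁_mul (x y : A) : leg₁ (x * y) = leg₁ x * leg₁ y := by
  apply MultiplierAlgebra.ext' <;> refine TensorProduct.ext' fun p q => ?_
  · change (x * y * p) ⊗ₜ[ℂ] q = (x * (y * p)) ⊗ₜ q
    rw [mul_assoc]
  · change (p * (x * y)) ⊗ₜ[ℂ] q = ((p * x) * y) ⊗ₜ q
    rw [mul_assoc]

theorem leg₁_mul_leg₂ (x y : A) : leg₁ x * leg₂ y = ofElem (x ⊗ₜ[ℂ] y) := by
  apply MultiplierAlgebra.ext' <;> exact TensorProduct.ext' fun p q => by simp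

theorem leg₂_mul_leg₁ (x y : A) : leg₂ y * leg₁ x = ofElem (x ⊗ₜ[ℂ] y) := by
  apply MultiplierAlgebra.ext' <;> exact TensorProduct.ext' fun p q => by simp

theorem flipM_flipM (m : MultiplierAlgebra (A ⊗[ℂ] A)) : flipM (flipM m) = m := by
  apply MultiplierAlgebra.ext' <;> refine LinearMap.ext fun t => ?_
  · change swap (swap (m.left (swap (swap t)))) = _
    simp
  · change swap (swap (m.right (swap (swap t)))) = _
    simp

theorem flipM_leg₂ (x : A) : flipM (leg₂ x) = leg₁ x := by
  apply MultiplierAlgebra.ext' <;> exact TensorProduct.ext' fun p q => rfl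

theorem flipM_ofElem (t : A ⊗[ℂ] A) : flipM (ofElem t) = ofElem (swap t) := by
  apply MultiplierAlgebra.ext' <;> refine LinearMap.ext fun s => ?_
  · change swap (t * swap s) = swap t * s
    rw [swap_mul, swap_swap]
  · change swap (swap s * t) = s * swap t
    rw [swap_mul, swap_swap]

/-- The slice map `ι ⊗ ω : A ⊗ A → A`, bilinear in `ω` and the tensor. -/
def sl : Module.Dual ℂ A →ₗ[ℂ] A ⊗[ℂ] A →ₗ[ℂ] A :=
  (LinearMap.llcomp ℂ (A ⊗[ℂ] A) (A ⊗[ℂ] ℂ) A (TensorProduct.rid ℂ A).toLinearMap) ∘ₗ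
    LinearMap.lTensorHom A

@[simp] theorem sl_tmul (ω : Module.Dual ℂ A) (x y : A) : sl ω (x ⊗ₜ y) = ω y • x := by
  simp [sl]

theorem sl_leg₁_right (ω : Module.Dual ℂ A) (c : A) (t : A ⊗[ℂ] A) :
    sl ω ((leg₁ c).right t) = sl ω t * c := by
  induction t using TensorProduct.induction_on with
  | zero => simp
  | add s t hs ht => simp [hs, ht, add_mul]
  | tmul x y =>
    change sl ω ((x * c) ⊗ₜ y) = _
    simp [smul_mul_assoc]

theorem sl_leg₁_left (ω : Module.Dual ℂ A) (c : A) (t : A ⊗[ℂ] A) :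
    sl ω ((leg₁ c).left t) = c * sl ω t := by
  induction t using TensorProduct.induction_on with
  | zero => simp
  | add s t hs ht => simp [hs, ht, mul_add]
  | tmul x y =>
    change sl ω ((c * x) ⊗ₜ y) = _
    simp [mul_smul_comm]

/-- The functional `φ( · c)`. -/
def shift (φ : Module.Dual ℂ A) : A →ₗ[ℂ] Module.Dual ℂ A :=
  (LinearMap.mul ℂ A).flip.compr₂ φ

@[simp] theorem shift_apply (φ : Module.Dual ℂ A) (c a : A) : shift φ c a = φ (a * c) := rfl

theorem sl_shift (φ : Module.Dual ℂ A) (c : A) (t : A ⊗[ℂ] A) :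
    sl (shift φ c) t = sl φ ((leg₂ c).right t) := by
  induction t using TensorProduct.induction_on with
  | zero => simp
  | add s t hs ht => simp [hs, ht]
  | tmul x y =>
    change _ = sl φ (x ⊗ₜ (y * c))
    simp

end Aux

namespace IsRegularMultiplierHopf

variable {A : Type*} [NonUnitalRing A] [Module ℂ A] [SMulCommClass ℂ A A] [IsScalarTower ℂ A A]
variable {Δ : A →ₙₐ[ℂ] MultiplierAlgebra (A ⊗[ℂ] A)}

/-- `T₁ (a ⊗ b) = Δ(a)(1 ⊗ b)`. -/
def T₁ (h : IsRegularMultiplierHopf Δ) : (A ⊗[ℂ] A) ≃ₗ[ℂ] (A ⊗[ℂ] A) := h.1.2.choose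

/-- `T₂ (a ⊗ b) = (a ⊗ 1)Δ(b)`. -/
def T₂ (h : IsRegularMultiplierHopf Δ) : (A ⊗[ℂ] A) ≃ₗ[ℂ] (A ⊗[ℂ] A) :=
  h.1.2.choose_spec.choose

/-- `T₃ (a ⊗ b) = Δ(a)(b ⊗ 1)`. -/
def T₃ (h : IsRegularMultiplierHopf Δ) : (A ⊗[ℂ] A) ≃ₗ[ℂ] (A ⊗[ℂ] A) :=
  h.2.2.choose.trans (TensorProduct.comm ℂ A A)

theorem T₁_spec (h : IsRegularMultiplierHopf Δ) (a b : A) :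
    ofElem (h.T₁ (a ⊗ₜ b)) = Δ a * leg₂ b := h.1.2.choose_spec.choose_spec.1 a b

theorem T₂_spec (h : IsRegularMultiplierHopf Δ) (a b : A) :
    ofElem (h.T₂ (a ⊗ₜ b)) = leg₁ a * Δ b := h.1.2.choose_spec.choose_spec.2.1 a b

theorem coassoc (h : IsRegularMultiplierHopf Δ) (a b c : A) :
    TensorProduct.assoc ℂ A A A (h.T₂.toLinearMap.rTensor A
      ((TensorProduct.assoc ℂ A A A).symm (a ⊗ₜ h.T₁ (b ⊗ₜ c)))) =
    h.T₁.toLinearMap.lTensor A (TensorProduct.assoc ℂ A A A (h.T₂ (a ⊗ₜ b) ⊗ₜ c)) :=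
  h.1.2.choose_spec.choose_spec.2.2 a b c

theorem T₃_spec (h : IsRegularMultiplierHopf Δ) (a b : A) :
    ofElem (h.T₃ (a ⊗ₜ b)) = Δ a * leg₁ b := by
  have h1 := h.2.2.choose_spec.choose_spec.1 a b
  have h2 := congrArg flipM h1
  rw [flipM_ofElem, map_mul, flipM_leg₂, NonUnitalAlgHom.comp_apply, flipM_flipM] at h2
  exact h2

theorem inj (h : IsRegularMultiplierHopf Δ) :
    Function.Injective (ofElem : A ⊗[ℂ] A →ₗ[ℂ] MultiplierAlgebra (A ⊗[ℂ] A)) :=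
  ofElem_injective (nondegenerate_tensor h.1.1)

/-- The multiplier `(ι ⊗ ω)Δ(a)` of `A`, for a linear functional `ω` on `A` and `a ∈ A`:
`((ι ⊗ ω)Δ(a)) x = (ι ⊗ ω)(Δ(a)(x ⊗ 1))` and `x ((ι ⊗ ω)Δ(a)) = (ι ⊗ ω)((x ⊗ 1)Δ(a))`. -/
def slice (h : IsRegularMultiplierHopf Δ) :
    Module.Dual ℂ A →ₗ[ℂ] A →ₗ[ℂ] MultiplierAlgebra A :=
  LinearMap.mk₂ ℂ
    (fun ω a => ⟨(sl ω ∘ₗ h.T₃.toLinearMap ∘ₗ TensorProduct.mk ℂ A A a,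
        MulOpposite.op (sl ω ∘ₗ h.T₂.toLinearMap ∘ₗ (TensorProduct.mk ℂ A A).flip a)), by
      refine ⟨fun x y => ?_, fun x y => ?_, fun x y => ?_⟩
      · change sl ω (h.T₃ (a ⊗ₜ (x * y))) = sl ω (h.T₃ (a ⊗ₜ x)) * y
        rw [← sl_leg₁_right]
        congr 1
        apply h.inj
        rw [← ofElem_mul, T₃_spec, T₃_spec, leg₁_mul, mul_assoc]
      · change sl ω (h.T₂ ((x * y) ⊗ₜ a)) = x * sl ω (h.T₂ (y ⊗ₜ a))
        rw [← sl_leg₁_left]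
        congr 1
        apply h.inj
        rw [← mul_ofElem, T₂_spec, T₂_spec, leg₁_mul, mul_assoc]
      · change sl ω (h.T₂ (x ⊗ₜ a)) * y = x * sl ω (h.T₃ (a ⊗ₜ y))
        rw [← sl_leg₁_left, ← sl_leg₁_right]
        congr 1
        apply h.inj
        rw [← mul_ofElem, ← ofElem_mul, T₂_spec, T₃_spec, mul_assoc]⟩)
    (fun ω ω' a => MultiplierAlgebra.ext'
      (LinearMap.ext fun x => by
        change sl (ω + ω') (h.T₃ (a ⊗ₜ x)) = sl ω (h.T₃ (a ⊗ₜ x)) + sl ω' (h.T₃ (a ⊗ₜ x))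
        rw [map_add, LinearMap.add_apply])
      (LinearMap.ext fun x => by
        change sl (ω + ω') (h.T₂ (x ⊗ₜ a)) = sl ω (h.T₂ (x ⊗ₜ a)) + sl ω' (h.T₂ (x ⊗ₜ a))
        rw [map_add, LinearMap.add_apply]))
    (fun r ω a => MultiplierAlgebra.ext'
      (LinearMap.ext fun x => by
        change sl (r • ω) (h.T₃ (a ⊗ₜ x)) = r • sl ω (h.T₃ (a ⊗ₜ x))
        rw [map_smul, LinearMap.smul_apply])
      (LinearMap.ext fun x => by
        change sl (r • ω) (h.T₂ (x ⊗ₜ a)) = r • sl ω (h.T₂ (x ⊗ₜ a))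
        rw [map_smul, LinearMap.smul_apply]))
    (fun ω a a' => MultiplierAlgebra.ext'
      (LinearMap.ext fun x => by
        change sl ω (h.T₃ ((a + a') ⊗ₜ x)) = sl ω (h.T₃ (a ⊗ₜ x)) + sl ω (h.T₃ (a' ⊗ₜ x))
        rw [TensorProduct.add_tmul, map_add, map_add])
      (LinearMap.ext fun x => by
        change sl ω (h.T₂ (x ⊗ₜ (a + a'))) = sl ω (h.T₂ (x ⊗ₜ a)) + sl ω (h.T₂ (x ⊗ₜ a'))
        rw [TensorProduct.tmul_add, map_add, map_add]))
    (fun r ω a => MultiplierAlgebra.ext'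
      (LinearMap.ext fun x => by
        change sl ω (h.T₃ ((r • a) ⊗ₜ x)) = r • sl ω (h.T₃ (a ⊗ₜ x))
        rw [← TensorProduct.smul_tmul', map_smul, map_smul])
      (LinearMap.ext fun x => by
        change sl ω (h.T₂ (x ⊗ₜ (r • a))) = r • sl ω (h.T₂ (x ⊗ₜ a))
        rw [TensorProduct.tmul_smul, map_smul, map_smul]))

theorem slice_left (h : IsRegularMultiplierHopf Δ) (ω : Module.Dual ℂ A) (a x : A) :
    (h.slice ω a).left x = sl ω (h.T₃ (a ⊗ₜ x)) := rfl

theorem slice_right (h : IsRegularMultiplierHopf Δ) (ω : Module.Dual ℂ A) (a x : A) :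
    (h.slice ω a).right x = sl ω (h.T₂ (x ⊗ₜ a)) := rfl

/-- `(ι ⊗ φ( · c))Δ(a)` is the element `(ι ⊗ φ)(Δ(a)(1 ⊗ c))` of `A`. -/
theorem slice_shift (h : IsRegularMultiplierHopf Δ) (φ : Module.Dual ℂ A) (c a : A) :
    ofElem (sl φ (h.T₁ (a ⊗ₜ c))) = h.slice (shift φ c) a := by
  apply MultiplierAlgebra.ext' <;> refine LinearMap.ext fun x => ?_
  · rw [slice_left, sl_shift, ofElem_left, ← sl_leg₁_right]
    congr 1
    apply h.inj
    rw [← ofElem_mul, ← ofElem_mul, T₁_spec, T₃_spec, mul_assoc, mul_assoc, leg₁_mul_leg₂,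
      leg₂_mul_leg₁]
  · rw [slice_right, sl_shift, ofElem_right, ← sl_leg₁_left]
    congr 1
    apply h.inj
    rw [← mul_ofElem, ← ofElem_mul, T₁_spec, T₂_spec, mul_assoc]

end IsRegularMultiplierHopf

/-- An algebraic quantum group, with a chosen left integral `φ`: a regular multiplier Hopf
algebra `(A, Δ)` together with a non-zero linear functional `φ` such that
`(ι ⊗ φ)Δ(a) = φ(a) 1` in `M(A)` for all `a`. -/
structure AlgebraicQuantumGroup (A : Type*) [NonUnitalRing A] [Module ℂ A]
    [SMulCommClass ℂ A A] [IsScalarTower ℂ A A] where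
  Δ : A →ₙₐ[ℂ] MultiplierAlgebra (A ⊗[ℂ] A)
  regular : IsRegularMultiplierHopf Δ
  φ : Module.Dual ℂ A
  φ_ne_zero : φ ≠ 0
  left_invariant : ∀ a, regular.slice φ a = φ a • (1 : MultiplierAlgebra A)

namespace AlgebraicQuantumGroup

variable {A : Type*} [NonUnitalRing A] [Module ℂ A] [SMulCommClass ℂ A A] [IsScalarTower ℂ A A]
variable (G : AlgebraicQuantumGroup A)

/-- The underlying space of the dual: the functionals `φ( · c)` with `c ∈ A`. -/
def Dual : Type _ := LinearMap.range (shift G.φ)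

instance : AddCommGroup G.Dual := inferInstanceAs (AddCommGroup (LinearMap.range (shift G.φ)))

instance : Module ℂ G.Dual := inferInstanceAs (Module ℂ (LinearMap.range (shift G.φ)))

/-- An element of the dual, as a functional on `A`. -/
def toFunctional : G.Dual →ₗ[ℂ] Module.Dual ℂ A := (LinearMap.range (shift G.φ)).subtype

theorem toFunctional_injective : Function.Injective G.toFunctional :=
  (LinearMap.range (shift G.φ)).subtype_injective

/-- The functional `φ( · c)`, as an element of the dual. -/
def hat : A →ₗ[ℂ] G.Dual := (shift G.φ).rangeRestrict

theorem hat_surjective : Function.Surjective G.hat := (shift G.φ).surjective_rangeRestrict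

@[simp] theorem toFunctional_hat (c : A) : G.toFunctional (G.hat c) = shift G.φ c := rfl

/-- The pairing `⟨a, b⟩` of `A` with its dual, by evaluation. -/
def pairing : A →ₗ[ℂ] G.Dual →ₗ[ℂ] ℂ := G.toFunctional.flip

theorem pairing_hat (a c : A) : G.pairing a (G.hat c) = G.φ (a * c) := rfl

theorem slice_mem (b : G.Dual) (a : A) :
    ∃ y : A, ofElem y = G.regular.slice (G.toFunctional b) a := by
  obtain ⟨c, rfl⟩ := G.hat_surjective b
  exact ⟨_, G.regular.slice_shift G.φ c a⟩

theorem emb_injective (G : AlgebraicQuantumGroup A) : Function.Injective (ofElem : A →ₗ[ℂ] MultiplierAlgebra A) :=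
  ofElem_injective G.regular.1.1

/-- The element `b ▷ a = (ι ⊗ ⟨ · , b⟩)Δ(a)` of `M(A)`, which lies in `A`. -/
def actFun (b : G.Dual) (a : A) : A := (G.slice_mem b a).choose

theorem ofElem_actFun (b : G.Dual) (a : A) :
    ofElem (G.actFun b a) = G.regular.slice (G.toFunctional b) a := (G.slice_mem b a).choose_spec

/-- The left action `b ▷ a = (ι ⊗ ⟨ · , b⟩)Δ(a)` of the dual on `A`. -/
def act : G.Dual →ₗ[ℂ] A →ₗ[ℂ] A :=
  LinearMap.mk₂ ℂ G.actFun
    (fun b b' a => G.emb_injective (by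
      simp only [ofElem_actFun, map_add, LinearMap.add_apply]))
    (fun r b a => G.emb_injective (by
      simp only [ofElem_actFun, map_smul, LinearMap.smul_apply]))
    (fun b a a' => G.emb_injective (by simp only [ofElem_actFun, map_add]))
    (fun r b a => G.emb_injective (by simp only [ofElem_actFun, map_smul]))

theorem ofElem_act (b : G.Dual) (a : A) :
    ofElem (G.act b a) = G.regular.slice (G.toFunctional b) a := G.ofElem_actFun b a

theorem mul_act (b : G.Dual) (a x : A) :
    x * G.act b a = sl (G.toFunctional b) (G.regular.T₂ (x ⊗ₜ a)) :=
  congrArg (fun m : MultiplierAlgebra A => m.right x) (G.ofElem_act b a)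

theorem act_hat (c a : A) : G.act (G.hat c) a = sl G.φ (G.regular.T₁ (a ⊗ₜ c)) :=
  G.emb_injective ((G.ofElem_act _ _).trans (G.regular.slice_shift G.φ c a).symm)

theorem sl_T₃ (p q : A) : sl G.φ (G.regular.T₃ (p ⊗ₜ q)) = G.φ p • q :=
  congrArg (fun m : MultiplierAlgebra A => m.left q) (G.left_invariant p)

theorem left_T₃ (a p q : A) :
    (G.Δ a).left (G.regular.T₃ (p ⊗ₜ q)) = G.regular.T₃ ((a * p) ⊗ₜ q) := by
  apply G.regular.inj
  rw [← mul_ofElem, IsRegularMultiplierHopf.T₃_spec, IsRegularMultiplierHopf.T₃_spec,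
    map_mul, mul_assoc]

/-- `(b' ▷ a) c = (ι ⊗ φ)(Δ(a)(c ⊗ c'))` for `b' = φ( · c')`. -/
theorem act_hat_mul (a c c' : A) :
    G.act (G.hat c') a * c = sl G.φ ((G.Δ a).left (c ⊗ₜ c')) := by
  rw [act_hat, ← sl_leg₁_right]
  congr 1
  apply G.regular.inj
  rw [← ofElem_mul, IsRegularMultiplierHopf.T₁_spec, ← mul_ofElem, mul_assoc, leg₂_mul_leg₁]

theorem mul_mem (b b' : G.Dual) :
    ∃ d : G.Dual, G.toFunctional d = G.toFunctional b ∘ₗ G.act b' := by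
  obtain ⟨c, rfl⟩ := G.hat_surjective b
  obtain ⟨c', rfl⟩ := G.hat_surjective b'
  suffices H : ∀ t : A ⊗[ℂ] A, ∃ d : G.Dual, ∀ a, G.toFunctional d a =
      G.φ (sl G.φ ((G.Δ a).left t)) by
    obtain ⟨d, hd⟩ := H (c ⊗ₜ c')
    refine ⟨d, LinearMap.ext fun a => ?_⟩
    rw [hd, ← act_hat_mul]
    rfl
  intro t
  obtain ⟨s, rfl⟩ := G.regular.T₃.surjective t
  induction s using TensorProduct.induction_on with
  | zero => exact ⟨0, fun a => by simp⟩
  | add s s' hs hs' =>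
    obtain ⟨d, hd⟩ := hs
    obtain ⟨d', hd'⟩ := hs'
    exact ⟨d + d', fun a => by simp only [map_add, LinearMap.add_apply, hd, hd']⟩
  | tmul p q =>
    refine ⟨G.φ q • G.hat p, fun a => ?_⟩
    rw [left_T₃, sl_T₃]
    simp [mul_comm]

/-- The product `b b'` of the dual: the functional `a ↦ ⟨Δ(a), b ⊗ b'⟩ = ⟨b' ▷ a, b⟩`, where
`b' ▷ a = (ι ⊗ ⟨ · , b'⟩)Δ(a)`. -/
def mulFun (b b' : G.Dual) : G.Dual := (G.mul_mem b b').choose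

theorem toFunctional_mulFun (b b' : G.Dual) :
    G.toFunctional (G.mulFun b b') = G.toFunctional b ∘ₗ G.act b' := (G.mul_mem b b').choose_spec

/-- The product of the dual as a bilinear map. -/
def dualMul : G.Dual →ₗ[ℂ] G.Dual →ₗ[ℂ] G.Dual :=
  LinearMap.mk₂ ℂ G.mulFun
    (fun b b' d => G.toFunctional_injective (by
      simp only [toFunctional_mulFun, map_add, LinearMap.add_comp]))
    (fun r b d => G.toFunctional_injective (by
      simp only [toFunctional_mulFun, map_smul, LinearMap.smul_comp]))
    (fun b d d' => G.toFunctional_injective (by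
      simp only [toFunctional_mulFun, map_add, LinearMap.comp_add]))
    (fun r b d => G.toFunctional_injective (by
      simp only [toFunctional_mulFun, map_smul, LinearMap.comp_smul]))

instance : Mul G.Dual := ⟨fun b b' => G.dualMul b b'⟩

theorem toFunctional_mul (b b' : G.Dual) :
    G.toFunctional (b * b') = G.toFunctional b ∘ₗ G.act b' := G.toFunctional_mulFun b b'

theorem pairing_mul (a : A) (b b' : G.Dual) :
    G.pairing a (b * b') = G.pairing (G.act b' a) b :=
  LinearMap.congr_fun (G.toFunctional_mul b b') a

theorem sl_comp_act (ω : Module.Dual ℂ A) (b : G.Dual) (c : A) (hb : b = G.hat c) (t : A ⊗[ℂ] A) :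
    sl (ω ∘ₗ G.act b) t = sl ω ((sl G.φ).lTensor A
      (G.regular.T₁.toLinearMap.lTensor A (TensorProduct.assoc ℂ A A A (t ⊗ₜ c)))) := by
  induction t using TensorProduct.induction_on with
  | zero => simp
  | add s t hs ht => simp only [map_add, TensorProduct.add_tmul, hs, ht]
  | tmul x y => subst hb; simp [act_hat]

theorem T₂_sl (x : A) (t : A ⊗[ℂ] A) :
    G.regular.T₂ (x ⊗ₜ sl G.φ t) = (sl G.φ).lTensor A (TensorProduct.assoc ℂ A A A
      (G.regular.T₂.toLinearMap.rTensor A ((TensorProduct.assoc ℂ A A A).symm (x ⊗ₜ t)))) := by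
  have key : ∀ (s : A ⊗[ℂ] A) (z : A), (sl G.φ).lTensor A
      (TensorProduct.assoc ℂ A A A (s ⊗ₜ z)) = G.φ z • s := by
    intro s z
    induction s using TensorProduct.induction_on with
    | zero => simp
    | add s t hs ht => simp only [map_add, TensorProduct.add_tmul, hs, ht, smul_add]
    | tmul x y => simp [TensorProduct.tmul_smul]
  induction t using TensorProduct.induction_on with
  | zero => simp
  | add s t hs ht => simp only [map_add, TensorProduct.tmul_add, hs, ht]
  | tmul y z => simp [key, TensorProduct.tmul_smul]

/-- `A` is a left module over the dual. -/
theorem mul_act_apply (b b' : G.Dual) (a : A) : G.act (b * b') a = G.act b (G.act b' a) := by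
  obtain ⟨c', hc⟩ := G.hat_surjective b'
  have : ∀ x, x * (G.act (b * b') a - G.act b (G.act b' a)) = 0 := by
    intro x
    rw [mul_sub, mul_act, mul_act, toFunctional_mul, G.sl_comp_act _ b' c' hc.symm,
      ← G.regular.coassoc, ← T₂_sl, ← act_hat, hc, sub_self]
  exact sub_eq_zero.1 (G.regular.1.1.2 _ this)

instance : NonUnitalRing G.Dual where
  left_distrib b c d := map_add (G.dualMul b) c d
  right_distrib b c d := LinearMap.congr_fun (map_add G.dualMul b c) d
  zero_mul b := LinearMap.congr_fun (map_zero G.dualMul) b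
  mul_zero b := map_zero (G.dualMul b)
  mul_assoc b c d := G.toFunctional_injective (LinearMap.ext fun a => by
    rw [toFunctional_mul, toFunctional_mul, toFunctional_mul]
    simp only [LinearMap.comp_apply, mul_act_apply])

/-- The pairing of `A ⊗ A` with `Â ⊗ Â`, as a map from `Â ⊗ Â` to the functionals on `A ⊗ A`. -/
def pairing₂ : G.Dual ⊗[ℂ] G.Dual →ₗ[ℂ] Module.Dual ℂ (A ⊗[ℂ] A) :=
  TensorProduct.dualDistrib ℂ A A ∘ₗ TensorProduct.map G.toFunctional G.toFunctional

@[simp] theorem pairing₂_tmul (b b' : G.Dual) (a a' : A) :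
    G.pairing₂ (b ⊗ₜ b') (a ⊗ₜ a') = G.pairing a b * G.pairing a' b' := rfl

theorem pairing₂_injective : Function.Injective G.pairing₂ := by
  rw [injective_iff_map_eq_zero]
  intro t ht
  have key : ∀ (t : G.Dual ⊗[ℂ] G.Dual) (a a' : A), G.pairing₂ t (a ⊗ₜ a') =
      G.pairing a' (TensorProduct.lid ℂ G.Dual ((G.pairing a).rTensor G.Dual t)) := by
    intro t a a'
    induction t using TensorProduct.induction_on with
    | zero => simp
    | add s t hs ht => simp only [map_add, LinearMap.add_apply, hs, ht]
    | tmul b b' => simp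
  refine rTensor_separates (fun a => G.pairing a) (fun b hb =>
    G.toFunctional_injective (LinearMap.ext hb)) t fun a => ?_
  apply (TensorProduct.lid ℂ G.Dual).injective
  rw [map_zero]
  refine G.toFunctional_injective (LinearMap.ext fun a' => ?_)
  exact (key t a a').symm.trans (by rw [ht]; rfl)

/-- For `b, b'` in the dual, the functional `a ⊗ a' ↦ ⟨a (b' ▷ a'), b⟩ = ⟨a ⊗ (b' ▷ a'), Δ(b)⟩`
on `A ⊗ A`; this is the pairing with `Δ(b)(1 ⊗ b')`. -/
def coprodFunctional : G.Dual ⊗[ℂ] G.Dual →ₗ[ℂ] Module.Dual ℂ (A ⊗[ℂ] A) :=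
  TensorProduct.lift (LinearMap.mk₂ ℂ
    (fun b b' => G.toFunctional b ∘ₗ TensorProduct.lift ((LinearMap.mul ℂ A).compl₂ (G.act b')))
    (fun b b' d => by rw [map_add, LinearMap.add_comp])
    (fun r b d => by rw [map_smul, LinearMap.smul_comp])
    (fun b d d' => TensorProduct.ext' fun x y => by simp [mul_add])
    (fun r b d => TensorProduct.ext' fun x y => by simp))

@[simp] theorem coprodFunctional_tmul (b b' : G.Dual) (a a' : A) :
    G.coprodFunctional (b ⊗ₜ b') (a ⊗ₜ a') = G.pairing (a * G.act b' a') b := rfl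

theorem coprod_mem (t : G.Dual ⊗[ℂ] G.Dual) : ∃ s, G.pairing₂ s = G.coprodFunctional t := by
  induction t using TensorProduct.induction_on with
  | zero => exact ⟨0, by simp⟩
  | add s t hs ht =>
    obtain ⟨d, hd⟩ := hs
    obtain ⟨d', hd'⟩ := ht
    exact ⟨d + d', by simp only [map_add, hd, hd']⟩
  | tmul b b' =>
    obtain ⟨c, rfl⟩ := G.hat_surjective b
    obtain ⟨c', rfl⟩ := G.hat_surjective b'
    suffices H : ∀ t : A ⊗[ℂ] A, ∃ d, ∀ a a', G.pairing₂ d (a ⊗ₜ a') =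
        G.φ (a * sl G.φ ((G.Δ a').left t)) by
      obtain ⟨d, hd⟩ := H (c ⊗ₜ c')
      refine ⟨d, TensorProduct.ext' fun a a' => ?_⟩
      rw [hd, ← act_hat_mul, coprodFunctional_tmul, pairing_hat, mul_assoc]
    intro t
    obtain ⟨s, rfl⟩ := G.regular.T₃.surjective t
    induction s using TensorProduct.induction_on with
    | zero => exact ⟨0, fun a => by simp⟩
    | add s s' hs hs' =>
      obtain ⟨d, hd⟩ := hs
      obtain ⟨d', hd'⟩ := hs'
      exact ⟨d + d', fun a a' => by simp only [map_add, LinearMap.add_apply, mul_add, hd, hd']⟩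
    | tmul p q =>
      refine ⟨G.hat q ⊗ₜ G.hat p, fun a a' => ?_⟩
      rw [left_T₃, sl_T₃, pairing₂_tmul, pairing_hat, pairing_hat, mul_smul_comm, map_smul,
        smul_eq_mul, mul_comm]

/-- The coproduct of the dual, in the form of the map `b ⊗ b' ↦ Δ(b)(1 ⊗ b')` of `Â ⊗ Â` into
itself, characterized by `⟨a ⊗ a', Δ(b)(1 ⊗ b')⟩ = ⟨a ⊗ (b' ▷ a'), Δ(b)⟩ = ⟨a (b' ▷ a'), b⟩`. -/
def dualT₁ : G.Dual ⊗[ℂ] G.Dual →ₗ[ℂ] G.Dual ⊗[ℂ] G.Dual :=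
  (LinearEquiv.ofInjective G.pairing₂ G.pairing₂_injective).symm.toLinearMap ∘ₗ
    LinearMap.codRestrict _ G.coprodFunctional fun t => G.coprod_mem t

theorem pairing₂_dualT₁ (t : G.Dual ⊗[ℂ] G.Dual) :
    G.pairing₂ (G.dualT₁ t) = G.coprodFunctional t :=
  congrArg Subtype.val
    ((LinearEquiv.ofInjective G.pairing₂ G.pairing₂_injective).apply_symm_apply
      (LinearMap.codRestrict _ G.coprodFunctional (fun t => G.coprod_mem t) t))

/-- The underlying space `A ⊗ Â` of the Heisenberg algebra. -/
def Heisenberg : Type _ := A ⊗[ℂ] G.Dual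

instance : AddCommGroup G.Heisenberg := inferInstanceAs (AddCommGroup (A ⊗[ℂ] G.Dual))

instance : Module ℂ G.Heisenberg := inferInstanceAs (Module ℂ (A ⊗[ℂ] G.Dual))

/-- The element `a ⊗ b` of the Heisenberg algebra. -/
def Heisenberg.tmul : A →ₗ[ℂ] G.Dual →ₗ[ℂ] G.Heisenberg := TensorProduct.mk ℂ A G.Dual

/-- The map `p ⊗ q ↦ a (p ▷ a') ⊗ q` from `Â ⊗ Â` to `A ⊗ Â`. -/
def heisenbergTwist (a a' : A) : G.Dual ⊗[ℂ] G.Dual →ₗ[ℂ] A ⊗[ℂ] G.Dual :=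
  (LinearMap.mulLeft ℂ a ∘ₗ G.act.flip a').rTensor G.Dual

@[simp] theorem heisenbergTwist_tmul (a a' : A) (p q : G.Dual) :
    G.heisenbergTwist a a' (p ⊗ₜ q) = (a * G.act p a') ⊗ₜ q := rfl

/-- Left multiplication by `a ⊗ b` in the Heisenberg algebra,
`(a ⊗ b)(a' ⊗ b') = ∑ ⟨a'₍₂₎, b₍₁₎⟩ a a'₍₁₎ ⊗ b₍₂₎ b'`.  In other words the product is
`∑ᵢ a (pᵢ ▷ a') ⊗ qᵢ` where `∑ᵢ pᵢ ⊗ qᵢ = Δ(b)(1 ⊗ b')`. -/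
def heisenbergMulLeft (a : A) (b : G.Dual) : A ⊗[ℂ] G.Dual →ₗ[ℂ] A ⊗[ℂ] G.Dual :=
  TensorProduct.lift (LinearMap.mk₂ ℂ
    (fun (a' : A) (b' : G.Dual) => G.heisenbergTwist a a' (G.dualT₁ (b ⊗ₜ b')))
    (fun x y d => by simp [heisenbergTwist, LinearMap.comp_add, LinearMap.rTensor_add])
    (fun r x d => by simp [heisenbergTwist, LinearMap.comp_smul, LinearMap.rTensor_smul])
    (fun x d d' => by simp [TensorProduct.tmul_add])
    (fun r x d => by simp))

theorem heisenbergMulLeft_tmul (a a' : A) (b b' : G.Dual) :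
    G.heisenbergMulLeft a b (a' ⊗ₜ b') = G.heisenbergTwist a a' (G.dualT₁ (b ⊗ₜ b')) := rfl

/-- The product of the Heisenberg algebra, as a bilinear map. -/
def heisenbergMul : A ⊗[ℂ] G.Dual →ₗ[ℂ] A ⊗[ℂ] G.Dual →ₗ[ℂ] A ⊗[ℂ] G.Dual :=
  TensorProduct.lift (LinearMap.mk₂ ℂ G.heisenbergMulLeft
    (fun x y d => TensorProduct.ext' fun a b => by
      simp only [LinearMap.add_apply, heisenbergMulLeft_tmul, heisenbergTwist, mulLeft_add',
        LinearMap.add_comp, LinearMap.rTensor_add])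
    (fun r x d => TensorProduct.ext' fun a b => by
      simp only [LinearMap.smul_apply, heisenbergMulLeft_tmul, heisenbergTwist, mulLeft_smul',
        LinearMap.smul_comp, LinearMap.rTensor_smul])
    (fun x d d' => TensorProduct.ext' fun a b => by
      simp only [LinearMap.add_apply, heisenbergMulLeft_tmul, TensorProduct.add_tmul, map_add])
    (fun r x d => TensorProduct.ext' fun a b => by
      simp only [LinearMap.smul_apply, heisenbergMulLeft_tmul, ← TensorProduct.smul_tmul',
        map_smul]))

instance : Mul G.Heisenberg := ⟨fun u v => (G.heisenbergMul u v : A ⊗[ℂ] G.Dual)⟩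

instance : NonUnitalNonAssocRing G.Heisenberg where
  left_distrib u v w := map_add (G.heisenbergMul u) v w
  right_distrib u v w := LinearMap.congr_fun (map_add G.heisenbergMul u v) w
  zero_mul u := LinearMap.congr_fun (map_zero G.heisenbergMul) u
  mul_zero u := map_zero (G.heisenbergMul u)

theorem Heisenberg.tmul_mul_tmul (a a' : A) (b b' : G.Dual) :
    Heisenberg.tmul G a b * Heisenberg.tmul G a' b' =
      G.heisenbergTwist a a' (G.dualT₁ (b ⊗ₜ b')) := rfl

/-- The rank one operator `x ↦ a ⟨x, b⟩` on `A`. -/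
def rankOne (a : A) (b : G.Dual) : Module.End ℂ A := (G.toFunctional b).smulRight a

theorem rankOne_apply (a x : A) (b : G.Dual) : G.rankOne a b x = G.pairing x b • a := rfl

/-- The algebra of operators on `A` spanned by the rank one operators `x ↦ a ⟨x, b⟩`. -/
def finiteRankAlgebra : NonUnitalSubalgebra ℂ (Module.End ℂ A) where
  __ := Submodule.span ℂ {T : Module.End ℂ A | ∃ a b, T = G.rankOne a b}
  mul_mem' := by
    intro S T hS hT
    refine Submodule.span_induction₂ (p := fun S T _ _ => S * T ∈
      Submodule.span ℂ {T : Module.End ℂ A | ∃ a b, T = G.rankOne a b}) ?_ ?_ ?_ ?_ ?_ ?_ ?_ hS hT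
    · rintro _ _ ⟨a, b, rfl⟩ ⟨a', b', rfl⟩
      have : G.rankOne a b * G.rankOne a' b' = G.pairing a' b • G.rankOne a b' := by
        ext x
        simp [rankOne_apply, smul_smul, mul_comm]
      rw [this]
      exact Submodule.smul_mem _ _ (Submodule.subset_span ⟨a, b', rfl⟩)
    · intro T _; simp
    · intro T _; simp
    · intro S T U _ _ _ h h'; rw [add_mul]; exact add_mem h h'
    · intro S T U _ _ _ h h'; rw [mul_add]; exact add_mem h h'
    · intro r S T _ _ h; rw [smul_mul_assoc]; exact Submodule.smul_mem _ _ h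
    · intro r S T _ _ h; rw [mul_smul_comm]; exact Submodule.smul_mem _ _ h

end AlgebraicQuantumGroup

end QGroup

end

/-!
Write `Φ(a ⊗ b)` for the operator `x ↦ a (b ▷ x)` and `R(a ⊗ b)` for `x ↦ a ⟨x, b⟩`.

`Φ` is injective: `Φ(t) x · y` depends only on `R(t)` and `T₃(x ⊗ y) = Δ(x)(y ⊗ 1)`. These elements
exhaust `A ⊗ A`, so `Φ(t) = 0` forces `R(t) v · u = 0` for all `u, v`, and `R` is injective because
`A` separates the points of its dual.

`Φ` and `R` have the same range: left invariance of `φ` gives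
`S(a (φ( · c) ▷ x)) = (ι ⊗ φ)((1 ⊗ x)Δ(c)(S(a) ⊗ 1))`, so composing with the antipode `S` carries
the range of `Φ` onto that of `R`, and it preserves the range of `R`. The antipode is the map with
`S ⊗ ι = T₂⁻¹ T₄ T₁⁻¹`, where `T₄(a ⊗ b) = (1 ⊗ a)Δ(b)`; that the right side has this form follows
from `e S(x) = (ι ⊗ ε)(T₂⁻¹(e ⊗ x))`.

`Φ` is multiplicative: `y Φ(t) x z`, with `t = ∑ aᵢ (pᵢ ▷ a') ⊗ qᵢ` and `∑ pᵢ ⊗ qᵢ = Δ(b)(1 ⊗ b')`,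
is obtained by pairing `∑ pᵢ ⊗ qᵢ` with the second legs of `(ya ⊗ 1)Δ(a')` and `Δ(x)(z ⊗ 1)`.
-/

noncomputable section

namespace QGroup

section Tensor

theorem rid_lTensor_rTensor {R M N P : Type*} [CommSemiring R] [AddCommMonoid M] [Module R M]
    [AddCommMonoid N] [Module R N] [AddCommMonoid P] [Module R P] (η : N →ₗ[R] R) (g : M →ₗ[R] P)
    (t : M ⊗[R] N) :
    TensorProduct.rid R P (η.lTensor P (g.rTensor N t)) =
      g (TensorProduct.rid R M (η.lTensor M t)) := by
  induction t with
  | zero => simp only [map_zero]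
  | add s t hs ht => simp only [map_add, hs, ht]
  | tmul x y => simp

section Descent

variable {L M N P Q : Type*} [AddCommGroup L] [Module ℂ L] [AddCommGroup M] [Module ℂ M]
  [AddCommGroup N] [Module ℂ N] [AddCommGroup P] [Module ℂ P] [Nontrivial N]

theorem bijective_of_rTensor_bijective {S : L →ₗ[ℂ] M}
    (hS : Function.Bijective (S.rTensor N)) : Function.Bijective S := by
  rw [← Module.FaithfullyFlat.lTensor_bijective_iff_bijective ℂ N,
    ← LinearMap.comm_comp_rTensor_comp_comm_eq]
  exact (TensorProduct.comm ℂ M N).bijective.comp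
    (hS.comp (TensorProduct.comm ℂ N L).bijective)

theorem exists_rTensor_eq_of_separating (f : Q → M →ₗ[ℂ] P) (hf : ∀ m, (∀ q, f q m = 0) → m = 0)
    (κ : Q → L →ₗ[ℂ] P) (Θ : L ⊗[ℂ] N →ₗ[ℂ] M ⊗[ℂ] N)
    (hΘ : ∀ q, (f q).rTensor N ∘ₗ Θ = (κ q).rTensor N) :
    ∃ S : L →ₗ[ℂ] M, S.rTensor N = Θ := by
  obtain ⟨z, hz⟩ := exists_ne (0 : N)
  obtain ⟨η, hη⟩ := Module.Projective.exists_dual_eq_one ℂ hz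
  let S : L →ₗ[ℂ] M := (TensorProduct.rid ℂ M).toLinearMap ∘ₗ η.lTensor M ∘ₗ Θ ∘ₗ
    (TensorProduct.mk ℂ L N).flip z
  have hS (q : Q) : f q ∘ₗ S = κ q := LinearMap.ext fun p => calc
    f q (S p) = TensorProduct.rid ℂ P (η.lTensor P ((f q).rTensor N (Θ (p ⊗ₜ z)))) :=
      (rid_lTensor_rTensor η (f q) _).symm
    _ = TensorProduct.rid ℂ P (η.lTensor P (κ q p ⊗ₜ z)) :=
      congrArg _ (congrArg _ (LinearMap.congr_fun (hΘ q) (p ⊗ₜ z)))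
    _ = κ q p := by simp [hη]
  refine ⟨S, LinearMap.ext fun t => sub_eq_zero.1 (rTensor_separates f hf _ fun q => ?_)⟩
  rw [map_sub, sub_eq_zero, ← LinearMap.rTensor_comp_apply, hS]
  exact (LinearMap.congr_fun (hΘ q) t).symm

end Descent

variable {A : Type*} [NonUnitalRing A] [Module ℂ A]

theorem sl_rTensor (ω : Module.Dual ℂ A) (f : A →ₗ[ℂ] A) (t : A ⊗[ℂ] A) :
    sl ω (f.rTensor A t) = f (sl ω t) :=
  rid_lTensor_rTensor ω f t

theorem lid_rTensor_lTensor_assoc_tmul (ω : Module.Dual ℂ A) (t : A ⊗[ℂ] A) (c : A) :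
    ((TensorProduct.lid ℂ A).toLinearMap ∘ₗ ω.rTensor A).lTensor A
      (TensorProduct.assoc ℂ A A A (t ⊗ₜ c)) = sl ω t ⊗ₜ c := by
  induction t with
  | zero => simp
  | add s t hs ht => simp only [map_add, TensorProduct.add_tmul, hs, ht]
  | tmul x y => simp [sl, TensorProduct.smul_tmul]

variable [SMulCommClass ℂ A A] [IsScalarTower ℂ A A]

theorem leg₂_mul (x y : A) : leg₂ (x * y) = leg₂ x * leg₂ y := by
  apply MultiplierAlgebra.ext' <;> exact TensorProduct.ext' fun p q => by simp [mul_assoc]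

theorem leg₁_mul_leg₂_comm (x y : A) : leg₁ x * leg₂ y = leg₂ y * leg₁ x :=
  (leg₁_mul_leg₂ x y).trans (leg₂_mul_leg₁ x y).symm

theorem flipM_leg₁ (x : A) : flipM (leg₁ x) = leg₂ x := by
  rw [← flipM_leg₂, flipM_flipM]

theorem leg₁_left_lTensor (f : A →ₗ[ℂ] A) (x : A) (t : A ⊗[ℂ] A) :
    (leg₁ x).left (f.lTensor A t) = f.lTensor A ((leg₁ x).left t) :=
  LinearMap.congr_fun ((LinearMap.rTensor_comp_lTensor ..).trans
    (LinearMap.lTensor_comp_rTensor ..).symm) t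

theorem leg₁_right_lTensor (f : A →ₗ[ℂ] A) (x : A) (t : A ⊗[ℂ] A) :
    (leg₁ x).right (f.lTensor A t) = f.lTensor A ((leg₁ x).right t) :=
  LinearMap.congr_fun ((LinearMap.rTensor_comp_lTensor ..).trans
    (LinearMap.lTensor_comp_rTensor ..).symm) t

theorem lTensor_mul'_assoc_tmul (t : A ⊗[ℂ] A) (c : A) :
    (LinearMap.mul' ℂ A).lTensor A (TensorProduct.assoc ℂ A A A (t ⊗ₜ c)) = (leg₂ c).right t := by
  induction t with
  | zero => simp
  | add s t hs ht => simp only [map_add, TensorProduct.add_tmul, hs, ht]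
  | tmul x y => simp

end Tensor

/-- The map `f ⊗ ι` of `A ⊗ A ⊗ A`, acting on the first two legs of a right-bracketed tensor. -/
def onFirstTwo {A : Type*} [AddCommGroup A] [Module ℂ A] (f : A ⊗[ℂ] A ≃ₗ[ℂ] A ⊗[ℂ] A) :
    A ⊗[ℂ] (A ⊗[ℂ] A) ≃ₗ[ℂ] A ⊗[ℂ] (A ⊗[ℂ] A) :=
  (TensorProduct.assoc ℂ A A A).symm ≪≫ₗ f.rTensor A ≪≫ₗ TensorProduct.assoc ℂ A A A

@[simp] theorem onFirstTwo_tmul {A : Type*} [AddCommGroup A] [Module ℂ A]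
    (f : A ⊗[ℂ] A ≃ₗ[ℂ] A ⊗[ℂ] A) (x y z : A) :
    onFirstTwo f (x ⊗ₜ (y ⊗ₜ z)) = TensorProduct.assoc ℂ A A A (f (x ⊗ₜ y) ⊗ₜ z) := rfl

theorem onFirstTwo_symm {A : Type*} [AddCommGroup A] [Module ℂ A]
    (f : A ⊗[ℂ] A ≃ₗ[ℂ] A ⊗[ℂ] A) : onFirstTwo f.symm = (onFirstTwo f).symm := rfl

namespace IsRegularMultiplierHopf

variable {A : Type*} [NonUnitalRing A] [Module ℂ A] [SMulCommClass ℂ A A] [IsScalarTower ℂ A A]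
variable {Δ : A →ₙₐ[ℂ] MultiplierAlgebra (A ⊗[ℂ] A)} (h : IsRegularMultiplierHopf Δ)

/-- `T₄ (a ⊗ b) = (1 ⊗ a)Δ(b)`. -/
def T₄ : (A ⊗[ℂ] A) ≃ₗ[ℂ] (A ⊗[ℂ] A) :=
  h.2.2.choose_spec.choose.trans (TensorProduct.comm ℂ A A)

theorem T₄_spec (a b : A) : ofElem (h.T₄ (a ⊗ₜ b)) = leg₂ a * Δ b := by
  have hflip := congrArg flipM (h.2.2.choose_spec.choose_spec.2.1 a b)
  rw [flipM_ofElem, map_mul, flipM_leg₁, NonUnitalAlgHom.comp_apply, flipM_flipM] at hflip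
  exact hflip

theorem T₁_mul_left (x y c : A) : h.T₁ ((x * y) ⊗ₜ c) = (Δ x).left (h.T₁ (y ⊗ₜ c)) := by
  apply h.inj
  rw [← mul_ofElem, T₁_spec, T₁_spec, map_mul, mul_assoc]

theorem T₄_mul_left (x y c : A) : h.T₄ ((x * y) ⊗ₜ c) = (leg₂ x).left (h.T₄ (y ⊗ₜ c)) := by
  apply h.inj
  rw [← mul_ofElem, T₄_spec, T₄_spec, leg₂_mul, mul_assoc]

theorem T₂_leg₁_left (e : A) (t : A ⊗[ℂ] A) :
    h.T₂ ((leg₁ e).left t) = (leg₁ e).left (h.T₂ t) := by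
  induction t with
  | zero => simp only [map_zero]
  | add s t hs ht => simp only [map_add, hs, ht]
  | tmul a b =>
    apply h.inj
    rw [← mul_ofElem, leg₁_left, T₂_spec, T₂_spec, leg₁_mul, mul_assoc]

theorem T₂_leg₂_right (d : A) (t : A ⊗[ℂ] A) :
    h.T₂ ((leg₂ d).right t) = (Δ d).right (h.T₂ t) := by
  induction t with
  | zero => simp only [map_zero]
  | add s t hs ht => simp only [map_add, hs, ht]
  | tmul a b =>
    apply h.inj
    rw [← ofElem_mul, leg₂_right, T₂_spec, T₂_spec, map_mul, mul_assoc]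

theorem leg₂_right_T₂ (a b c : A) :
    (leg₂ c).right (h.T₂ (a ⊗ₜ b)) = (leg₁ a).left (h.T₁ (b ⊗ₜ c)) := by
  apply h.inj
  rw [← ofElem_mul, ← mul_ofElem, T₂_spec, T₁_spec, mul_assoc]

theorem leg₁_right_T₂ (a b c : A) :
    (leg₁ c).right (h.T₂ (a ⊗ₜ b)) = (leg₁ a).left (h.T₃ (b ⊗ₜ c)) := by
  apply h.inj
  rw [← ofElem_mul, ← mul_ofElem, T₂_spec, T₃_spec, mul_assoc]

theorem leg₁_right_T₄ (a b c : A) :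
    (leg₁ c).right (h.T₄ (a ⊗ₜ b)) = (leg₂ a).left (h.T₃ (b ⊗ₜ c)) := by
  apply h.inj
  rw [← ofElem_mul, ← mul_ofElem, T₄_spec, T₃_spec, mul_assoc]

theorem leg₂_left_T₂ (a b c : A) :
    (leg₂ c).left (h.T₂ (a ⊗ₜ b)) = (leg₁ a).left (h.T₄ (c ⊗ₜ b)) := by
  apply h.inj
  rw [← mul_ofElem, ← mul_ofElem, T₂_spec, T₄_spec, ← mul_assoc, ← mul_assoc,
    leg₁_mul_leg₂_comm]

theorem leg₁_left_T₄ (a b c : A) :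
    (leg₁ c).left (h.T₄ (a ⊗ₜ b)) = (Δ b).right (c ⊗ₜ a) := by
  apply h.inj
  rw [← ofElem_mul, ← mul_ofElem, T₄_spec, ← leg₁_mul_leg₂, mul_assoc]

theorem leg₁_right_T₁ (a b c : A) :
    (leg₁ c).right (h.T₁ (a ⊗ₜ b)) = (Δ a).left (c ⊗ₜ b) := by
  apply h.inj
  rw [← mul_ofElem, ← ofElem_mul, T₁_spec, mul_assoc, leg₂_mul_leg₁]

theorem leg₁_right_T₂_mul (a b c d : A) :
    (leg₁ d).right (h.T₂ (a ⊗ₜ (b * c))) = h.T₂ (a ⊗ₜ b) * h.T₃ (c ⊗ₜ d) := by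
  apply h.inj
  rw [← ofElem_mul, ← ofElem_left (h.T₂ (a ⊗ₜ b)), ← mul_ofElem, T₂_spec, T₂_spec, T₃_spec, map_mul]
  simp only [mul_assoc]

theorem onFirstTwo_T₂_lTensor_T₁ (t : A ⊗[ℂ] (A ⊗[ℂ] A)) :
    onFirstTwo h.T₂ (h.T₁.lTensor A t) = h.T₁.lTensor A (onFirstTwo h.T₂ t) := by
  suffices hcomp : (onFirstTwo h.T₂).toLinearMap ∘ₗ (h.T₁.lTensor A).toLinearMap =
      (h.T₁.lTensor A).toLinearMap ∘ₗ (onFirstTwo h.T₂).toLinearMap from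
    LinearMap.congr_fun hcomp t
  ext a b c
  exact h.coassoc a b c

theorem lTensor_T₁_symm_onFirstTwo_T₂ (t : A ⊗[ℂ] (A ⊗[ℂ] A)) :
    (h.T₁.lTensor A).symm (onFirstTwo h.T₂ t) = onFirstTwo h.T₂ ((h.T₁.lTensor A).symm t) := by
  rw [LinearEquiv.symm_apply_eq, ← onFirstTwo_T₂_lTensor_T₁, LinearEquiv.apply_symm_apply]

theorem onFirstTwo_T₂_symm_lTensor_T₁ (t : A ⊗[ℂ] (A ⊗[ℂ] A)) :
    onFirstTwo h.T₂.symm (h.T₁.lTensor A t) = h.T₁.lTensor A (onFirstTwo h.T₂.symm t) := by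
  rw [onFirstTwo_symm, LinearEquiv.symm_apply_eq, onFirstTwo_T₂_lTensor_T₁,
    LinearEquiv.apply_symm_apply]

theorem lTensor_mul'_onFirstTwo_T₂ (a : A) (t : A ⊗[ℂ] A) :
    (LinearMap.mul' ℂ A).lTensor A (onFirstTwo h.T₂ (a ⊗ₜ t)) = (leg₁ a).left (h.T₁ t) := by
  induction t with
  | zero => simp only [TensorProduct.tmul_zero, map_zero]
  | add s t hs ht => simp only [TensorProduct.tmul_add, map_add, hs, ht]
  | tmul b c => rw [onFirstTwo_tmul, lTensor_mul'_assoc_tmul, leg₂_right_T₂]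

theorem lTensor_mul'_T₁_symm_assoc_T₂ (t : A ⊗[ℂ] A) (c : A) :
    (LinearMap.mul' ℂ A).lTensor A
      ((h.T₁.lTensor A).symm (TensorProduct.assoc ℂ A A A (h.T₂ t ⊗ₜ c))) =
      LinearMap.mul' ℂ A t ⊗ₜ c := by
  induction t with
  | zero => simp only [TensorProduct.zero_tmul, map_zero]
  | add s t hs ht => simp only [TensorProduct.add_tmul, map_add, hs, ht]
  | tmul a b =>
    rw [← onFirstTwo_tmul, lTensor_T₁_symm_onFirstTwo_T₂]
    exact (h.lTensor_mul'_onFirstTwo_T₂ a (h.T₁.symm (b ⊗ₜ c))).trans (by simp)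

theorem tmul_mul'_T₁_symm (p q c : A) :
    p ⊗ₜ[ℂ] LinearMap.mul' ℂ A (h.T₁.symm (q ⊗ₜ c)) =
      LinearMap.mul' ℂ A (h.T₂.symm (p ⊗ₜ q)) ⊗ₜ[ℂ] c := by
  rw [← h.lTensor_mul'_T₁_symm_assoc_T₂, LinearEquiv.apply_symm_apply]
  rfl

/-- The functional `ε` is a counit: `(ε ⊗ ι)(Δ(a)(1 ⊗ b)) = ab`. -/
def IsCounit (ε : Module.Dual ℂ A) : Prop :=
  (TensorProduct.lid ℂ A).toLinearMap ∘ₗ ε.rTensor A ∘ₗ h.T₁.toLinearMap = LinearMap.mul' ℂ A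

theorem exists_isCounit [Nontrivial A] : ∃ ε, h.IsCounit ε := by
  obtain ⟨z, hz⟩ := exists_ne (0 : A)
  obtain ⟨η, hη⟩ := Module.Projective.exists_dual_eq_one ℂ hz
  let ε : Module.Dual ℂ A :=
    η ∘ₗ LinearMap.mul' ℂ A ∘ₗ h.T₂.symm.toLinearMap ∘ₗ TensorProduct.mk ℂ A A z
  have hε : (TensorProduct.lid ℂ A).toLinearMap ∘ₗ ε.rTensor A =
      LinearMap.mul' ℂ A ∘ₗ h.T₁.symm.toLinearMap := TensorProduct.ext' fun q c => by
    have hslice := congrArg (TensorProduct.lid ℂ A ∘ η.rTensor A) (h.tmul_mul'_T₁_symm z q c)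
    simpa [ε, hη] using hslice.symm
  refine ⟨ε, ?_⟩
  rw [IsCounit, ← LinearMap.comp_assoc, hε, LinearMap.comp_assoc, LinearEquiv.symm_comp,
    LinearMap.comp_id]

/-- The map `x ↦ e S(x)`, where `S` is the antipode, as `x ↦ (ι ⊗ ε)(T₂⁻¹(e ⊗ x))`. -/
def mulAntipode (ε : Module.Dual ℂ A) (e : A) : A →ₗ[ℂ] A :=
  sl ε ∘ₗ h.T₂.symm.toLinearMap ∘ₗ TensorProduct.mk ℂ A A e

theorem rTensor_mulAntipode (ε : Module.Dual ℂ A) (e : A) (t : A ⊗[ℂ] A) :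
    (h.mulAntipode ε e).rTensor A t =
      ((TensorProduct.lid ℂ A).toLinearMap ∘ₗ ε.rTensor A).lTensor A
        (onFirstTwo h.T₂.symm (e ⊗ₜ t)) := by
  induction t with
  | zero => simp only [TensorProduct.tmul_zero, map_zero]
  | add s t hs ht => simp only [TensorProduct.tmul_add, map_add, hs, ht]
  | tmul x y =>
    rw [onFirstTwo_tmul, lid_rTensor_lTensor_assoc_tmul]
    rfl

variable {h}

theorem IsCounit.rTensor_mulAntipode_T₁ {ε : Module.Dual ℂ A} (hε : h.IsCounit ε) (e x c : A) :
    (h.mulAntipode ε e).rTensor A (h.T₁ (x ⊗ₜ c)) =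
      (leg₂ c).right (h.T₂.symm (e ⊗ₜ x)) := by
  rw [rTensor_mulAntipode]
  calc
    _ = ((TensorProduct.lid ℂ A).toLinearMap ∘ₗ ε.rTensor A).lTensor A
          (h.T₁.lTensor A (onFirstTwo h.T₂.symm (e ⊗ₜ (x ⊗ₜ c)))) :=
      congrArg _ (h.onFirstTwo_T₂_symm_lTensor_T₁ (e ⊗ₜ (x ⊗ₜ c)))
    _ = (LinearMap.mul' ℂ A).lTensor A (onFirstTwo h.T₂.symm (e ⊗ₜ (x ⊗ₜ c))) := by
      rw [← hε]
      exact (LinearMap.lTensor_comp_apply A _ h.T₁.toLinearMap _).symm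
    _ = _ := by rw [onFirstTwo_tmul, lTensor_mul'_assoc_tmul]

variable (h) in
/-- The map `T₂⁻¹ T₄ T₁⁻¹`, which will turn out to be `S ⊗ ι` for the antipode `S`. -/
def antipodeTensor : (A ⊗[ℂ] A) ≃ₗ[ℂ] (A ⊗[ℂ] A) := h.T₁.symm ≪≫ₗ h.T₄ ≪≫ₗ h.T₂.symm

theorem IsCounit.leg₁_left_antipodeTensor {ε : Module.Dual ℂ A} (hε : h.IsCounit ε) (e : A)
    (t : A ⊗[ℂ] A) : (leg₁ e).left (h.antipodeTensor t) = (h.mulAntipode ε e).rTensor A t := by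
  obtain ⟨t, rfl⟩ := h.T₁.surjective t
  have hT₂ : h.T₂ (h.antipodeTensor (h.T₁ t)) = h.T₄ t := by simp [antipodeTensor]
  apply h.T₂.injective
  rw [T₂_leg₁_left, hT₂]
  clear hT₂
  induction t with
  | zero => simp only [map_zero]
  | add s t hs ht => simp only [map_add, hs, ht]
  | tmul x c =>
    rw [hε.rTensor_mulAntipode_T₁, T₂_leg₂_right, LinearEquiv.apply_symm_apply, leg₁_left_T₄]

variable (h) in
/-- `S` is an antipode: `T₂ (S ⊗ ι) T₁ = T₄`. In Sweedler notation this says that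
`S(a₍₁₎)a₍₂₎b₍₁₎ ⊗ a₍₃₎b₍₂₎ = b₍₁₎ ⊗ ab₍₂₎`. -/
def IsAntipode (S : A →ₗ[ℂ] A) : Prop := ∀ t, h.T₂ (S.rTensor A (h.T₁ t)) = h.T₄ t

theorem exists_isAntipode [Nontrivial A] : ∃ S : A ≃ₗ[ℂ] A, h.IsAntipode S.toLinearMap := by
  obtain ⟨ε, hε⟩ := h.exists_isCounit
  obtain ⟨S, hS⟩ := exists_rTensor_eq_of_separating (L := A) (M := A) (N := A) (P := A)
    (LinearMap.mulLeft ℂ) h.1.1.2 (h.mulAntipode ε) h.antipodeTensor.toLinearMap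
    fun e => LinearMap.ext (hε.leg₁_left_antipodeTensor e)
  have hbij : Function.Bijective S := bijective_of_rTensor_bijective (N := A) <| by
    rw [hS]
    exact h.antipodeTensor.bijective
  refine ⟨LinearEquiv.ofBijective S hbij, fun t => ?_⟩
  have hcoe : (LinearEquiv.ofBijective S hbij).toLinearMap = S := LinearMap.ext fun _ => rfl
  rw [hcoe, hS]
  simp [antipodeTensor]

theorem IsAntipode.T₂_rTensor_left {S : A →ₗ[ℂ] A} (hS : h.IsAntipode S) (x : A)
    (t : A ⊗[ℂ] A) :
    h.T₂ (S.rTensor A ((Δ x).left t)) = (leg₂ x).left (h.T₂ (S.rTensor A t)) := by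
  obtain ⟨t, rfl⟩ := h.T₁.surjective t
  induction t with
  | zero => simp only [map_zero]
  | add s t hs ht => simp only [map_add, hs, ht]
  | tmul y c => rw [← T₁_mul_left, hS, hS, T₄_mul_left]

theorem IsAntipode.rTensor_leg₁_right {S : A →ₗ[ℂ] A} (hS : h.IsAntipode S) (b : A)
    (t : A ⊗[ℂ] A) :
    S.rTensor A ((leg₁ b).right t) = (leg₁ (S b)).left (S.rTensor A t) := by
  obtain ⟨t, rfl⟩ := h.T₁.surjective t
  induction t with
  | zero => simp only [map_zero]
  | add s t hs ht => simp only [map_add, hs, ht]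
  | tmul a c =>
    apply h.T₂.injective
    rw [leg₁_right_T₁, hS.T₂_rTensor_left, T₂_leg₁_left, hS, LinearMap.rTensor_tmul,
      leg₂_left_T₂]

theorem IsAntipode.map_mul {S : A →ₗ[ℂ] A} (hS : h.IsAntipode S) (a b : A) :
    S (a * b) = S b * S a := by
  rcases subsingleton_or_nontrivial A with hA | hA
  · exact Subsingleton.elim _ _
  obtain ⟨d, hd⟩ := exists_ne (0 : A)
  obtain ⟨η, hη⟩ := Module.Projective.exists_dual_eq_one ℂ hd
  have hslice := congrArg (sl η) (hS.rTensor_leg₁_right b (a ⊗ₜ d))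
  simpa [hη] using hslice

end IsRegularMultiplierHopf

section SliceMul

variable {A : Type*} [NonUnitalRing A] [Module ℂ A] [SMulCommClass ℂ A A] [IsScalarTower ℂ A A]

/-- The element `∑ f(v ⊗ v') u u'` of `A`, for `w = ∑ u ⊗ v`, `w' = ∑ u' ⊗ v'` and a functional
`f` on `A ⊗ A`: the two first legs are multiplied and the two second legs are paired with `f`. -/
def sliceMul (w w' : A ⊗[ℂ] A) : Module.Dual ℂ (A ⊗[ℂ] A) →ₗ[ℂ] A :=
  (TensorProduct.rid ℂ A).toLinearMap ∘ₗ (LinearMap.lTensorHom A).flip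
    ((LinearMap.mul' ℂ A).rTensor (A ⊗[ℂ] A)
      (TensorProduct.tensorTensorTensorComm ℂ A A A A (w ⊗ₜ w')))

@[simp] theorem sliceMul_tmul_tmul (u v u' v' : A) (f : Module.Dual ℂ (A ⊗[ℂ] A)) :
    sliceMul (u ⊗ₜ v) (u' ⊗ₜ v') f = f (v ⊗ₜ v') • (u * u') := rfl

theorem sliceMul_add_left (w₁ w₂ w' : A ⊗[ℂ] A) :
    sliceMul (w₁ + w₂) w' = sliceMul w₁ w' + sliceMul w₂ w' := by
  simp only [sliceMul, TensorProduct.add_tmul, map_add, LinearMap.comp_add]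

theorem sliceMul_add_right (w w₁ w₂ : A ⊗[ℂ] A) :
    sliceMul w (w₁ + w₂) = sliceMul w w₁ + sliceMul w w₂ := by
  simp only [sliceMul, TensorProduct.tmul_add, map_add, LinearMap.comp_add]

theorem sliceMul_dualDistrib (ω ω' : Module.Dual ℂ A) (w w' : A ⊗[ℂ] A) :
    sliceMul w w' (TensorProduct.dualDistrib ℂ A A (ω ⊗ₜ ω')) = sl ω w * sl ω' w' := by
  induction w with
  | zero => simp [sliceMul]
  | add s t hs ht => simp only [sliceMul_add_left, map_add, LinearMap.add_apply, hs, ht, add_mul]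
  | tmul u v =>
    induction w' with
    | zero => simp [sliceMul]
    | add s t hs ht => simp only [sliceMul_add_right, map_add, LinearMap.add_apply, hs, ht, mul_add]
    | tmul u' v' => simp [smul_mul_smul_comm]

theorem sliceMul_comp_mul (ω : Module.Dual ℂ A) (f : A →ₗ[ℂ] A) (w w' : A ⊗[ℂ] A) :
    sliceMul w w' (ω ∘ₗ TensorProduct.lift ((LinearMap.mul ℂ A).compl₂ f)) =
      sl ω (w * f.lTensor A w') := by
  induction w with
  | zero => simp [sliceMul]
  | add s t hs ht => simp only [sliceMul_add_left, map_add, LinearMap.add_apply, hs, ht, add_mul]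
  | tmul u v =>
    induction w' with
    | zero => simp [sliceMul]
    | add s t hs ht => simp only [sliceMul_add_right, map_add, LinearMap.add_apply, hs, ht, mul_add]
    | tmul u' v' => simp

end SliceMul

namespace AlgebraicQuantumGroup

open IsRegularMultiplierHopf

variable {A : Type*} [NonUnitalRing A] [Module ℂ A] [SMulCommClass ℂ A A] [IsScalarTower ℂ A A]
variable (G : AlgebraicQuantumGroup A)

include G in
theorem nontrivial : Nontrivial A := by
  by_contra hA
  rw [not_nontrivial_iff_subsingleton] at hA
  exact G.φ_ne_zero (Subsingleton.elim _ _)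

theorem sl_T₂ (t : A ⊗[ℂ] A) : sl G.φ (G.regular.T₂ t) = sl G.φ t := by
  induction t with
  | zero => simp only [map_zero]
  | add s t hs ht => simp only [map_add, hs, ht]
  | tmul q p =>
    rw [sl_tmul]
    exact congrArg (fun m : MultiplierAlgebra A => m.right q) (G.left_invariant p)

theorem act_mul (b : G.Dual) (a x : A) :
    G.act b a * x = sl (G.toFunctional b) (G.regular.T₃ (a ⊗ₜ x)) :=
  congrArg (fun m : MultiplierAlgebra A => m.left x) (G.ofElem_act b a)

theorem lTensor_act_hat (c : A) (t : A ⊗[ℂ] A) :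
    (G.act (G.hat c)).lTensor A t = (sl G.φ).lTensor A
      (G.regular.T₁.toLinearMap.lTensor A (TensorProduct.assoc ℂ A A A (t ⊗ₜ c))) := by
  induction t with
  | zero => simp
  | add s t hs ht => simp only [map_add, TensorProduct.add_tmul, hs, ht]
  | tmul x y => simp [act_hat]

theorem T₂_act (b : G.Dual) (e x : A) :
    G.regular.T₂ (e ⊗ₜ G.act b x) = (G.act b).lTensor A (G.regular.T₂ (e ⊗ₜ x)) := by
  obtain ⟨c, rfl⟩ := G.hat_surjective b
  rw [act_hat, T₂_sl, G.regular.coassoc, lTensor_act_hat]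

theorem T₃_act (b : G.Dual) (x z : A) :
    G.regular.T₃ (G.act b x ⊗ₜ z) = (G.act b).lTensor A (G.regular.T₃ (x ⊗ₜ z)) := by
  refine sub_eq_zero.1 (leg₁_left_separates G.regular.1.1 _ fun e => ?_)
  rw [map_sub, sub_eq_zero, leg₁_left_lTensor, ← leg₁_right_T₂, ← leg₁_right_T₂, T₂_act,
    leg₁_right_lTensor]

/-- The action of the Heisenberg algebra on `A`: `a ⊗ b` acts as `x ↦ a (b ▷ x)`. -/
def heisenbergAction : A ⊗[ℂ] G.Dual →ₗ[ℂ] Module.End ℂ A :=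
  TensorProduct.lift ((LinearMap.llcomp ℂ A A A ∘ₗ LinearMap.mul ℂ A).compl₂ G.act)

@[simp] theorem heisenbergAction_tmul (a x : A) (b : G.Dual) :
    G.heisenbergAction (a ⊗ₜ b) x = a * G.act b x := rfl

/-- The map sending `a ⊗ b` to the rank one operator `x ↦ a ⟨x, b⟩`. -/
def rankOneMap : A ⊗[ℂ] G.Dual →ₗ[ℂ] Module.End ℂ A :=
  TensorProduct.lift (LinearMap.smulRightₗ ∘ₗ G.toFunctional).flip

@[simp] theorem rankOneMap_tmul (a x : A) (b : G.Dual) :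
    G.rankOneMap (a ⊗ₜ b) x = G.pairing x b • a := rfl

theorem rankOneMap_apply (t : A ⊗[ℂ] G.Dual) (x : A) :
    G.rankOneMap t x =
      TensorProduct.lid ℂ A ((G.pairing x).rTensor A (TensorProduct.comm ℂ A G.Dual t)) := by
  induction t with
  | zero => simp
  | add s t hs ht => simp only [map_add, LinearMap.add_apply, hs, ht]
  | tmul a b => simp

theorem rankOneMap_injective : Function.Injective G.rankOneMap := by
  rw [injective_iff_map_eq_zero]
  intro t ht
  refine (LinearEquiv.map_eq_zero_iff (TensorProduct.comm ℂ A G.Dual)).1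
    (rTensor_separates G.pairing
      (fun b hb => G.toFunctional_injective (LinearMap.ext hb)) _ fun x => ?_)
  rw [← LinearEquiv.map_eq_zero_iff (TensorProduct.lid ℂ A), ← rankOneMap_apply, ht,
    LinearMap.zero_apply]

theorem range_rankOneMap :
    LinearMap.range G.rankOneMap = G.finiteRankAlgebra.toSubmodule := by
  rw [LinearMap.range_eq_map, ← TensorProduct.span_tmul_eq_top, Submodule.map_span]
  refine congrArg (Submodule.span ℂ) (Set.ext fun T => ⟨?_, ?_⟩)
  · rintro ⟨_, ⟨a, b, rfl⟩, rfl⟩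
    exact ⟨a, b, rfl⟩
  · rintro ⟨a, b, rfl⟩
    exact ⟨_, ⟨a, b, rfl⟩, rfl⟩

theorem comp_rankOneMap (f : A →ₗ[ℂ] A) (t : A ⊗[ℂ] G.Dual) :
    f ∘ₗ G.rankOneMap t = G.rankOneMap (f.rTensor G.Dual t) := by
  induction t with
  | zero => simp
  | add s t hs ht => simp only [map_add, LinearMap.comp_add, hs, ht]
  | tmul a b => exact LinearMap.ext fun x => by simp

theorem rankOneMap_hat (t : A ⊗[ℂ] A) (x : A) :
    G.rankOneMap (G.hat.lTensor A t) x = sl G.φ ((leg₂ x).left t) := by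
  induction t with
  | zero => simp
  | add s t hs ht => simp only [map_add, LinearMap.add_apply, hs, ht]
  | tmul p q => simp [pairing_hat]

theorem antipode_heisenbergAction {S : A →ₗ[ℂ] A} (hS : G.regular.IsAntipode S) (a c x : A) :
    S (G.heisenbergAction (a ⊗ₜ G.hat c) x) =
      G.rankOneMap (G.hat.lTensor A (G.regular.T₃ (c ⊗ₜ S a))) x := calc
  S (a * G.act (G.hat c) x) = S (G.act (G.hat c) x) * S a := hS.map_mul _ _
  _ = sl G.φ (S.rTensor A (G.regular.T₁ (x ⊗ₜ c))) * S a := by rw [act_hat, sl_rTensor]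
  _ = sl G.φ (G.regular.T₄ (x ⊗ₜ c)) * S a := by rw [← sl_T₂, hS]
  _ = sl G.φ ((leg₂ x).left (G.regular.T₃ (c ⊗ₜ S a))) := by rw [← sl_leg₁_right, leg₁_right_T₄]
  _ = _ := (G.rankOneMap_hat _ x).symm

theorem range_comp_lTensor_hat {M : Type*} [AddCommGroup M] [Module ℂ M]
    (f : A ⊗[ℂ] G.Dual →ₗ[ℂ] M) :
    LinearMap.range (f ∘ₗ G.hat.lTensor A) = LinearMap.range f :=
  LinearMap.range_comp_of_range_eq_top f
    (LinearMap.range_eq_top.2 (LinearMap.lTensor_surjective A G.hat_surjective))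

theorem map_range_heisenbergAction {S : A ≃ₗ[ℂ] A} (hS : G.regular.IsAntipode S.toLinearMap) :
    (LinearMap.range G.heisenbergAction).map S.congrRight.toLinearMap =
      LinearMap.range G.rankOneMap := by
  let Γ : A ⊗[ℂ] A ≃ₗ[ℂ] A ⊗[ℂ] A :=
    S.rTensor A ≪≫ₗ TensorProduct.comm ℂ A A ≪≫ₗ G.regular.T₃
  have hΓ : S.congrRight.toLinearMap ∘ₗ G.heisenbergAction ∘ₗ G.hat.lTensor A =
      (G.rankOneMap ∘ₗ G.hat.lTensor A) ∘ₗ Γ.toLinearMap :=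
    TensorProduct.ext' fun a c => LinearMap.ext fun x => G.antipode_heisenbergAction hS a c x
  rw [← range_comp_lTensor_hat, ← LinearMap.range_comp, hΓ,
    LinearMap.range_comp_of_range_eq_top _ Γ.range, range_comp_lTensor_hat]

theorem map_range_rankOneMap (S : A ≃ₗ[ℂ] A) :
    (LinearMap.range G.rankOneMap).map S.congrRight.toLinearMap =
      LinearMap.range G.rankOneMap := by
  have hcomp : S.congrRight.toLinearMap ∘ₗ G.rankOneMap =
      G.rankOneMap ∘ₗ (S.rTensor G.Dual).toLinearMap :=
    LinearMap.ext fun t => G.comp_rankOneMap S.toLinearMap t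
  rw [← LinearMap.range_comp, hcomp, LinearMap.range_comp_of_range_eq_top _ (LinearEquiv.range _)]

theorem range_heisenbergAction :
    LinearMap.range G.heisenbergAction = G.finiteRankAlgebra.toSubmodule := by
  have := G.nontrivial
  obtain ⟨S, hS⟩ := G.regular.exists_isAntipode
  rw [← range_rankOneMap]
  apply Submodule.map_injective_of_injective S.congrRight.injective
  exact (G.map_range_heisenbergAction hS).trans (G.map_range_rankOneMap S).symm

theorem mul'_rTensor_rankOneMap_tmul (a : A) (b : G.Dual) (w : A ⊗[ℂ] A) :
    LinearMap.mul' ℂ A ((G.rankOneMap (a ⊗ₜ b)).rTensor A (TensorProduct.comm ℂ A A w)) =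
      a * sl (G.toFunctional b) w := by
  induction w with
  | zero => simp only [map_zero, mul_zero]
  | add s t hs ht => simp only [map_add, mul_add, hs, ht]
  | tmul u v => simp [pairing, smul_mul_assoc, mul_smul_comm]

theorem mul'_rTensor_rankOneMap_T₃ (t : A ⊗[ℂ] G.Dual) (x y : A) :
    LinearMap.mul' ℂ A ((G.rankOneMap t).rTensor A
      (TensorProduct.comm ℂ A A (G.regular.T₃ (x ⊗ₜ y)))) = G.heisenbergAction t x * y := by
  induction t with
  | zero => simp
  | add s t hs ht =>
    simp only [map_add, LinearMap.rTensor_add, LinearMap.add_apply, add_mul, hs, ht]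
  | tmul a b => rw [mul'_rTensor_rankOneMap_tmul, heisenbergAction_tmul, mul_assoc, act_mul]

theorem heisenbergAction_injective : Function.Injective G.heisenbergAction := by
  rw [injective_iff_map_eq_zero]
  intro t ht
  have hmul : LinearMap.mul' ℂ A ∘ₗ (G.rankOneMap t).rTensor A ∘ₗ
      (G.regular.T₃ ≪≫ₗ TensorProduct.comm ℂ A A).toLinearMap = 0 :=
    TensorProduct.ext' fun x y =>
      (G.mul'_rTensor_rankOneMap_T₃ t x y).trans (by simp [ht])
  have hrank : G.rankOneMap t = 0 := LinearMap.ext fun v => G.regular.1.1.1 _ fun u => by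
    simpa using LinearMap.congr_fun hmul (G.regular.T₃.symm (u ⊗ₜ v))
  exact G.rankOneMap_injective (hrank.trans (map_zero G.rankOneMap).symm)

theorem mul_heisenbergTwist_mul (a a' x y z : A) (t : G.Dual ⊗[ℂ] G.Dual) :
    y * G.heisenbergAction (G.heisenbergTwist a a' t) x * z =
      sliceMul (G.regular.T₂ ((y * a) ⊗ₜ a')) (G.regular.T₃ (x ⊗ₜ z)) (G.pairing₂ t) := by
  induction t with
  | zero => simp
  | add s t hs ht => simp only [map_add, LinearMap.add_apply, mul_add, add_mul, hs, ht]
  | tmul p q => calc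
    y * (a * G.act p a' * G.act q x) * z = (y * a) * G.act p a' * (G.act q x * z) := by
      simp only [mul_assoc]
    _ = _ := by
      rw [mul_act, act_mul]
      exact (sliceMul_dualDistrib ..).symm

theorem heisenbergAction_mul_tmul (a a' : A) (b b' : G.Dual) :
    G.heisenbergAction (G.heisenbergTwist a a' (G.dualT₁ (b ⊗ₜ b'))) =
      G.heisenbergAction (a ⊗ₜ b) * G.heisenbergAction (a' ⊗ₜ b') := by
  refine LinearMap.ext fun x => sub_eq_zero.1 (G.regular.1.1.2 _ fun y =>
    G.regular.1.1.1 _ fun z => ?_)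
  rw [mul_sub, sub_mul, sub_eq_zero]
  calc
    _ = sliceMul (G.regular.T₂ ((y * a) ⊗ₜ a')) (G.regular.T₃ (x ⊗ₜ z))
          (G.coprodFunctional (b ⊗ₜ b')) := by rw [mul_heisenbergTwist_mul, pairing₂_dualT₁]
    _ = sl (G.toFunctional b) (G.regular.T₂ ((y * a) ⊗ₜ a') *
          (G.act b').lTensor A (G.regular.T₃ (x ⊗ₜ z))) := sliceMul_comp_mul ..
    _ = sl (G.toFunctional b) ((leg₁ z).right
          (G.regular.T₂ ((y * a) ⊗ₜ (a' * G.act b' x)))) := by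
      rw [← T₃_act, leg₁_right_T₂_mul]
    _ = y * a * G.act b (a' * G.act b' x) * z := by rw [sl_leg₁_right, ← mul_act]
    _ = _ := by simp only [mul_assoc, Module.End.mul_apply, heisenbergAction_tmul]

theorem heisenbergAction_mul (u v : G.Heisenberg) :
    G.heisenbergAction (u * v : G.Heisenberg) = G.heisenbergAction u * G.heisenbergAction v := by
  have hmul : G.heisenbergMul.compr₂ G.heisenbergAction =
      (LinearMap.mul ℂ (Module.End ℂ A)).compl₁₂ G.heisenbergAction G.heisenbergAction :=
    TensorProduct.ext' fun a b => TensorProduct.ext' fun a' b' =>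
      G.heisenbergAction_mul_tmul a a' b b'
  exact LinearMap.congr_fun (LinearMap.congr_fun hmul u) v

end AlgebraicQuantumGroup

end QGroup

end

theorem proposition3p16 {A : Type*} [NonUnitalRing A] [Module ℂ A] [SMulCommClass ℂ A A]
    [IsScalarTower ℂ A A] (G : QGroup.AlgebraicQuantumGroup A) :
    ∃ e : G.Heisenberg ≃ₗ[ℂ] G.finiteRankAlgebra,
      (∀ u v : G.Heisenberg, e (u * v) = e u * e v) ∧
      ∀ (a : A) (b : G.Dual) (x : A),
        (e (QGroup.AlgebraicQuantumGroup.Heisenberg.tmul G a b) : Module.End ℂ A) x =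
          a * G.act b x := by
  let e : G.Heisenberg ≃ₗ[ℂ] G.finiteRankAlgebra :=
    (LinearEquiv.ofInjective G.heisenbergAction G.heisenbergAction_injective).trans
      (LinearEquiv.ofEq _ _ G.range_heisenbergAction)
  exact ⟨e, fun u v => Subtype.ext (G.heisenbergAction_mul u v), fun a b x => rfl⟩
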